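/- Let $K\ge 1$, $1\le j\le K$, $0\le\delta<1$, and let $\mathbb F_q$ be a finite field. Consider the $K$-user symmetric erasure broadcast channel with state feedback: in each slot $l$ the transmitter sends a packet $X_l\in\mathbb F_q$; each user receives $X_l$ or an erasure, the erasure having probability $\delta$, independently across users and slots. The state $S_l\subseteq[K]$ is the set of users that receive $X_l$. There are independent uniform messages $W_J\in\mathbb F_q^{F_J}$, $J\subseteq[K]$; $W_J$ is intended for all users in $J$ and is called of order $|J|$. In a code of length $n\ge1$, $X_l$ is a function of the messages and of $S_1,\dots,S_{l-1}$, and user $k$ decodes all $W_J$ with $k\in J$ from its outputs and $S_1,\dots,S_n$. Nonnegative order-$j$ rates $(R_J)_{|J|=j}$ are achievable if for every $\epsilon>0$ there is a code such that every user errs with probability less than $\epsilon$ and $R_J<F_J/n$ for all $|J|=j$. Put $$B=\frac{\binom Kj}{\sum_{k=1}^{K-j+1}\binom{K-k}{j-1}\frac1{1-\delta^k}} .$$ Then: (1) Every achievable order-$j$ rate tuple satisfies $\sum_{|J|=j}R_J\le B$. (2) The sum capacity of order-$j$ messages, i.e. the supremum of $\sum_{|J|=j}R_J$ over achievable tuples,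 equals $B$; so does the supremum of $\binom Kj\rho$ over the achievable tuples with equal rates $R_J=\rho$. (3) The multi-phase algorithm of Wang and of Gatzianas et al., started from phase $j$, achieves $B$. In this algorithm only order-$j$ messages are sent, $N$ packets each. Phases $m=j,\dots,K$ are run in this order, phase $m$ consisting of one sub-phase of $T_m$ consecutive slots for each $m$-subset $J$. Every packet sent in sub-phase $J$ is a linear combination, chosen from the past feedback, of the packets of $W_J$ if $m=j$, and, if $m>j$, of the packets that were sent in an earlier sub-phase $I\subsetneq J$ and received exactly by the users in $(J\setminus I)\cup I'$ for some $I'\subsetneq I$. Let $$t_j=\frac1{1-\delta^{K-j+1}},\qquad t_m=\frac1{1-\delta^{K-m+1}}\sum_{l=j}^{m-1}\binom{m-1}{l-1}t_l\,\delta^{K-m+1}(1-\delta)^{m-l}\quad(m>j).$$ For every $\epsilon>0$ and all sufficiently large $N$, there are lengths $T_m$ with $|T_m-t_mN|\le\epsilon N$ for $j\le m\le K$, a choice of the linear combinations, and decoders for which every user errs with probability less than $\epsilon$ and the sum rate satisfies $\left|\binom KjN/n-B\right|<\epsilon$, where $n\ge 1$ is the total number of slots. -/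

import Mathlib

namespace ErasureBC

/-- A packet-level message set: for every subset `J` of the `K` users a message `W_J` made of
`F J` packets, each packet being a symbol of the finite field `𝔽`. -/
abbrev Message (𝔽 : Type*) {K : ℕ} (F : Finset (Fin K) → ℕ) : Type _ :=
  (J : Finset (Fin K)) → Fin (F J) → 𝔽

/-- The individual message packets: a pair `⟨J, i⟩` is the `i`-th packet of `W_J`. -/
abbrev PacketIndex {K : ℕ} (F : Finset (Fin K) → ℕ) : Type :=
  (J : Finset (Fin K)) × Fin (F J)

/-- The states of the slots strictly before slot `l`.  The state of a slot is the set of users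
that receive the packet sent in that slot. -/
def past {K n : ℕ} (s : Fin n → Finset (Fin K)) (l : Fin n) : Fin (l : ℕ) → Finset (Fin K) :=
  fun i => s (i.castLE l.isLt.le)

/-- Probability of a state sequence: in each slot each user is erased with probability `δ`,
independently across slots and users. -/
noncomputable def stateProb {K n : ℕ} (δ : ℝ) (s : Fin n → Finset (Fin K)) : ℝ :=
  ∏ l : Fin n, ∏ k : Fin K, if k ∈ s l then 1 - δ else δ

/-- A code of length `n` for the `K`-user erasure broadcast channel with state feedback.
The encoder sees the messages and the strictly past states; receiver `k` sees its own output
sequence (`none` is an erasure) and the whole state sequence and estimates all `W_J`, `k ∈ J`. -/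
structure Code (𝔽 : Type*) (K n : ℕ) (F : Finset (Fin K) → ℕ) where
  enc : (l : Fin n) → Message 𝔽 F → (Fin (l : ℕ) → Finset (Fin K)) → 𝔽
  dec : (k : Fin K) → (Fin n → Option 𝔽) → (Fin n → Finset (Fin K)) →
    (J : {J : Finset (Fin K) // k ∈ J}) → Fin (F J) → 𝔽

namespace Code

variable {𝔽 : Type*} {K n : ℕ} {F : Finset (Fin K) → ℕ}

/-- The packet sent in slot `l`. -/
def input (c : Code 𝔽 K n F) (w : Message 𝔽 F) (s : Fin n → Finset (Fin K)) (l : Fin n) : 𝔽 :=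
  c.enc l w (past s l)

/-- The output of receiver `k`. -/
def output (c : Code 𝔽 K n F) (k : Fin K) (w : Message 𝔽 F) (s : Fin n → Finset (Fin K)) :
    Fin n → Option 𝔽 :=
  fun l => if k ∈ s l then some (c.input w s l) else none

/-- Receiver `k` gets at least one of its messages wrong. -/
def Err (c : Code 𝔽 K n F) (k : Fin K) (w : Message 𝔽 F) (s : Fin n → Finset (Fin K)) : Prop :=
  ∃ J : {J : Finset (Fin K) // k ∈ J}, c.dec k (c.output k w s) s J ≠ w J

open Classical in
/-- Error probability of receiver `k`, for independent and uniformly distributed messages. -/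
noncomputable def errorProb [Fintype 𝔽] (c : Code 𝔽 K n F) (δ : ℝ) (k : Fin K) : ℝ :=
  ∑ s : Fin n → Finset (Fin K), stateProb δ s *
    (((Finset.univ.filter fun w : Message 𝔽 F => c.Err k w s).card : ℝ) /
      (Fintype.card (Message 𝔽 F) : ℝ))

end Code

/-- The order-`j` rates `R_J`, `|J| = j`, are achievable: for every `ε > 0` some code has error
probability below `ε` at every receiver and conveys `W_J` at a rate (in packets per slot) above
`R_J` for every `j`-subset `J`.  The code may carry messages of other orders as well.
The values of `R` at sets of other cardinalities play no role. -/
def Achievable (𝔽 : Type*) [Fintype 𝔽] (K j : ℕ) (δ : ℝ) (R : Finset (Fin K) → ℝ) : Prop :=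
  (∀ J : Finset (Fin K), J.card = j → 0 ≤ R J) ∧
  ∀ ε : ℝ, 0 < ε → ∃ (n : ℕ) (F : Finset (Fin K) → ℕ) (c : Code 𝔽 K n F), 0 < n ∧
    (∀ k, c.errorProb δ k < ε) ∧
    ∀ J : Finset (Fin K), J.card = j → R J < (F J : ℝ) / (n : ℝ)

/-- The sum rate of order-`j` messages. -/
noncomputable def sumRate (K j : ℕ) (R : Finset (Fin K) → ℝ) : ℝ :=
  ∑ J ∈ (Finset.univ : Finset (Fin K)).powersetCard j, R J

/-- All sum rates of achievable order-`j` rate tuples. -/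
def sumRates (𝔽 : Type*) [Fintype 𝔽] (K j : ℕ) (δ : ℝ) : Set ℝ :=
  {r | ∃ R : Finset (Fin K) → ℝ, Achievable 𝔽 K j δ R ∧ r = sumRate K j R}

/-- All sum rates `C(K,j) R_J` of achievable order-`j` rate tuples with equal rates. -/
def symmetricSumRates (𝔽 : Type*) [Fintype 𝔽] (K j : ℕ) (δ : ℝ) : Set ℝ :=
  {r | ∃ ρ : ℝ, Achievable 𝔽 K j δ (fun _ => ρ) ∧ r = (K.choose j : ℝ) * ρ}

/-- `C(K,j) / ∑_{k=1}^{K-j+1} C(K-k,j-1) / (1 - δ^k)`. -/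
noncomputable def orderBound (K j : ℕ) (δ : ℝ) : ℝ :=
  (K.choose j : ℝ) /
    ∑ k ∈ Finset.Icc 1 (K - j + 1), ((K - k).choose (j - 1) : ℝ) / (1 - δ ^ k)

/-! ### The multi-phase broadcasting algorithm, started from phase `j` -/

/-- Message lengths when only order-`j` messages are sent, `N` packets each. -/
def orderLengths {K : ℕ} (j N : ℕ) : Finset (Fin K) → ℕ := fun J => if J.card = j then N else 0

/-- A time table of the algorithm started from phase `j`: phases `j, …, K` in this order, phase `m`
consisting of one sub-phase, of `T m` consecutive slots, for each `m`-subset of the users.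
`sub l` is the sub-phase that slot `l` belongs to. -/
structure IsSchedule {K n : ℕ} (j : ℕ) (T : ℕ → ℕ) (sub : Fin n → Finset (Fin K)) : Prop where
  phases_in_order : ∀ a b : Fin n, a ≤ b → (sub a).card ≤ (sub b).card
  consecutive : ∀ a b c : Fin n, a ≤ b → b ≤ c → sub a = sub c → sub b = sub a
  length : ∀ J : Finset (Fin K),
    (Finset.univ.filter fun l : Fin n => sub l = J).card = if j ≤ J.card then T J.card else 0

/-- The packets available to sub-phase `J`, each given by its coefficients over the message packets,
where `v l` is the packet sent in slot `l`.  In the starting phase they are the packets of `W_J`.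
Later they are the overheard packets: those sent in an earlier sub-phase `I ⊂ J`, and received
exactly by the users in `(J \ I) ∪ I'` for some proper subset `I'` of `I`. -/
def available {𝔽 : Type*} [Zero 𝔽] [One 𝔽] {K n : ℕ} {F : Finset (Fin K) → ℕ} (j : ℕ)
    (sub : Fin n → Finset (Fin K)) (s : Fin n → Finset (Fin K))
    (v : Fin n → PacketIndex F → 𝔽) (J : Finset (Fin K)) : Set (PacketIndex F → 𝔽) :=
  {x | (J.card = j ∧ ∃ i : Fin (F J), x = Pi.single ⟨J, i⟩ 1) ∨
    (j < J.card ∧ ∃ l : Fin n, sub l ⊂ J ∧ (∃ I' ⊂ sub l, s l = (J \ sub l) ∪ I') ∧ x = v l)}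

/-- The code is a run of the multi-phase broadcasting algorithm started from phase `j`, with
sub-phases of length `T m` in phase `m`: every packet sent in sub-phase `J` is a linear combination,
chosen from the past feedback, of the packets available to that sub-phase. -/
def IsMultiphase {𝔽 : Type*} [Field 𝔽] {K n : ℕ} {F : Finset (Fin K) → ℕ}
    (c : Code 𝔽 K n F) (j : ℕ) (T : ℕ → ℕ) : Prop :=
  ∃ (sub : Fin n → Finset (Fin K))
    (coef : (l : Fin n) → (Fin (l : ℕ) → Finset (Fin K)) → PacketIndex F → 𝔽),
    IsSchedule j T sub ∧
    (∀ l w p, c.enc l w p = ∑ d : PacketIndex F, coef l p d * w d.1 d.2) ∧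
    ∀ (s : Fin n → Finset (Fin K)) (l : Fin n),
      coef l (past s l) ∈
        Submodule.span 𝔽 (available j sub s (fun l' => coef l' (past s l')) (sub l))

/-- Length of a sub-phase of phase `m`, per packet of each order-`j` message, when the algorithm is
started from phase `j`: `t_j = 1 / (1 - δ^(K-j+1))` and, for `m > j`,
`t_m = (1 - δ^(K-m+1))⁻¹ ∑_{l=j}^{m-1} C(m-1,l-1) N_{l→m}` with
`N_{l→m} = t_l δ^(K-m+1) (1-δ)^(m-l)`.  (It is `0` for `m < j`.) -/
noncomputable def subphaseLength (K j : ℕ) (δ : ℝ) (m : ℕ) : ℝ :=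
  (if m = j then 1 else
    ∑ l : Fin m, if j ≤ (l : ℕ) then
      ((m - 1).choose ((l : ℕ) - 1) : ℝ) *
        (subphaseLength K j δ (l : ℕ) * δ ^ (K - m + 1) * (1 - δ) ^ (m - (l : ℕ)))
      else 0) / (1 - δ ^ (K - m + 1))
termination_by m
decreasing_by exact l.isLt

end ErasureBC

/-!
The sum capacity of order-`j` messages follows from two arguments that meet in a binomial identity.

*Converse.* Let the users cooperate in some order, so that `A` is the set of the first few of them.
Given the messages for `A`, let the innovation of a slot be the conditional entropy of its packet
given what `A` has received before (`innovation`).  With state feedback the state of a slot is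
independent of its innovation, so `A` receives on average exactly the fraction `1 - δ ^ |A|` of the
total innovation (`expected_logSize_sub_received`).  Enlarging `A` decreases innovations, and by
Fano's inequality the messages for the next user account for a drop of the total innovation
(`totalInnovation_sub_ge`).  These drops telescope to at most the number of slots, which gives
`∑ i, (∑ J with first user i, R J) / (1 - δ ^ i) ≤ 1` (`degraded_bound`).  Averaging over all orders
of the users replaces the inner sum by its symmetrization (`sumRate_le_orderBound`).  Entropies are
kept as sums of logarithms of class sizes (`logSize`), and all inequalities about them come from
Gibbs' inequality `logSize_sub_le`.

*Achievability.* Choose all coefficients of the linear combinations uniformly at random.  In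
sub-phase `J`, a user `k ∈ J` needs as many useful slots as there are available packets that it does
not know.  A slot is useful if its packet reaches `k` or some user outside `J`: in the second case
the packet is available again to a larger sub-phase, so that downward induction on `J` recovers it
(`eq_zero_of_fullRank`).  The recursion for the sub-phase lengths says that the two numbers have the
same mean; with a small margin (`margin_le_mean`) the first exceeds the second by a multiple of `N`.
A random matrix over any finite field is rank deficient with probability at most
`q ^ (columns - rows)`, and together with a Chernoff bound for the states this makes the error
probability exponentially small (`exists_table_errorProb_le`).

*Identity.* That the total length of the algorithm matches the converse follows from the
binomial transform of the sub-phase lengths, which is explicit (`sum_choose_mul_subphaseLength`).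
-/

namespace ErasureBC

/-! ### Probability of the states -/

/-- Probability that the set of users receiving a given slot is `x`. -/
noncomputable def slotProb {K : ℕ} (δ : ℝ) (x : Finset (Fin K)) : ℝ :=
  ∏ k : Fin K, if k ∈ x then 1 - δ else δ

section Probability

variable {K n : ℕ} {δ : ℝ}

lemma stateProb_eq (s : Fin n → Finset (Fin K)) : stateProb δ s = ∏ l, slotProb δ (s l) := rfl

lemma slotProb_nonneg (h0 : 0 ≤ δ) (h1 : δ ≤ 1) (x : Finset (Fin K)) : 0 ≤ slotProb δ x :=
  Finset.prod_nonneg fun k _ => by split_ifs <;> linarith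

lemma stateProb_nonneg (h0 : 0 ≤ δ) (h1 : δ ≤ 1) (s : Fin n → Finset (Fin K)) :
    0 ≤ stateProb δ s :=
  Finset.prod_nonneg fun l _ => slotProb_nonneg h0 h1 (s l)

/-- The probability that all users in `A` and no user in `B` receive a slot. -/
lemma sum_slotProb_indicator (A B : Finset (Fin K)) (hAB : Disjoint A B) :
    ∑ x, slotProb δ x * (if A ⊆ x ∧ Disjoint x B then 1 else 0) =
      (1 - δ) ^ A.card * δ ^ B.card := by
  have key : ∀ x : Finset (Fin K), slotProb δ x * (if A ⊆ x ∧ Disjoint x B then 1 else 0) =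
      (∏ k ∈ x, if k ∈ B then 0 else 1 - δ) *
        ∏ k ∈ Finset.univ \ x, if k ∈ A then 0 else δ := by
    intro x
    have hs : slotProb δ x = (∏ k ∈ x, (1 - δ)) * ∏ k ∈ Finset.univ \ x, δ := by
      rw [slotProb, Finset.prod_ite]
      congr 1
      · exact Finset.prod_congr (by ext; simp) fun _ _ => rfl
      · exact Finset.prod_congr (by ext; simp) fun _ _ => rfl
    by_cases h1 : Disjoint x B
    · by_cases h2 : A ⊆ x
      · rw [if_pos ⟨h2, h1⟩, mul_one, hs]
        congr 1
        · refine Finset.prod_congr rfl fun k hk => ?_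
          rw [if_neg (Finset.disjoint_left.1 h1 hk)]
        · refine Finset.prod_congr rfl fun k hk => ?_
          rw [if_neg fun hA => (Finset.mem_sdiff.1 hk).2 (h2 hA)]
      · rw [if_neg fun h => h2 h.1, mul_zero]
        obtain ⟨a, ha, hax⟩ := Finset.not_subset.1 h2
        rw [Finset.prod_eq_zero (s := Finset.univ \ x) (i := a) (by simpa using hax) (by simp [ha]),
          mul_zero]
    · rw [if_neg fun h => h1 h.2, mul_zero]
      obtain ⟨a, hax, haB⟩ := Finset.not_disjoint_iff.1 h1
      rw [Finset.prod_eq_zero (s := x) (i := a) hax (by simp [haB]), zero_mul]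
  simp_rw [key]
  rw [← Finset.powerset_univ, ← Finset.prod_add]
  have hpt : ∀ k : Fin K, ((if k ∈ B then (0 : ℝ) else 1 - δ) + if k ∈ A then 0 else δ) =
      (if k ∈ A then 1 - δ else 1) * if k ∈ B then δ else 1 := by
    intro k
    by_cases hA : k ∈ A
    · simp [hA, Finset.disjoint_left.1 hAB hA]
    · by_cases hB : k ∈ B <;> simp [hA, hB]
  simp_rw [hpt, Finset.prod_mul_distrib, Finset.prod_ite_mem, Finset.univ_inter,
    Finset.prod_const]

lemma sum_slotProb : ∑ x : Finset (Fin K), slotProb δ x = 1 := by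
  simpa using sum_slotProb_indicator (δ := δ) (∅ : Finset (Fin K)) ∅ (by simp)

lemma sum_stateProb_mul_prod (f : Fin n → Finset (Fin K) → ℝ) :
    ∑ s, stateProb δ s * ∏ l, f l (s l) = ∏ l, ∑ x, slotProb δ x * f l x := by
  rw [Finset.prod_univ_sum, Fintype.piFinset_univ]
  exact Finset.sum_congr rfl fun s _ => by rw [stateProb_eq, Finset.prod_mul_distrib]

lemma sum_stateProb : ∑ s : Fin n → Finset (Fin K), stateProb δ s = 1 := by
  simpa [sum_slotProb] using
    sum_stateProb_mul_prod (δ := δ) (fun (_ : Fin n) (_ : Finset (Fin K)) => 1)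

/-- The state of slot `l` is independent of anything determined by the other slots. -/
lemma sum_stateProb_mul_indep (l : Fin n) (g : Finset (Fin K) → ℝ)
    (h : (Fin n → Finset (Fin K)) → ℝ) (hh : ∀ s x, h (Function.update s l x) = h s) :
    ∑ s, stateProb δ s * (g (s l) * h s) =
      (∑ x, slotProb δ x * g x) * ∑ s, stateProb δ s * h s := by
  have hP : ∀ (s : Fin n → Finset (Fin K)) x,
      stateProb δ (Function.update s l x) * slotProb δ (s l) = slotProb δ x * stateProb δ s := by
    intro s x
    rw [stateProb_eq, stateProb_eq, ← Finset.mul_prod_erase _ _ (Finset.mem_univ l),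
      ← Finset.mul_prod_erase _ (fun i => slotProb δ (s i)) (Finset.mem_univ l),
      Function.update_self]
    rw [Finset.prod_congr rfl fun i hi => by rw [Function.update_of_ne (Finset.ne_of_mem_erase hi)]]
    ring
  -- Resampling slot `l` leaves the joint law of the old and the new state symmetric.
  let σ : Finset (Fin K) × (Fin n → Finset (Fin K)) → Finset (Fin K) × (Fin n → Finset (Fin K)) :=
    fun p => (p.2 l, Function.update p.2 l p.1)
  have hσ : Function.Involutive σ := fun p => by simp [σ]
  calc ∑ s, stateProb δ s * (g (s l) * h s)
      = ∑ p : Finset (Fin K) × (Fin n → Finset (Fin K)),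
          slotProb δ p.1 * stateProb δ p.2 * (g (p.2 l) * h p.2) := by
        rw [Fintype.sum_prod_type, Finset.sum_comm]
        refine Finset.sum_congr rfl fun s _ => ?_
        simp_rw [mul_assoc]
        rw [← Finset.sum_mul, sum_slotProb, one_mul]
    _ = ∑ p : Finset (Fin K) × (Fin n → Finset (Fin K)),
          slotProb δ p.1 * stateProb δ p.2 * (g p.1 * h p.2) := by
        refine Fintype.sum_equiv (hσ.toPerm σ) _ _ fun p => ?_
        have := hP p.2 p.1
        simp only [Function.Involutive.coe_toPerm, σ, hh]
        rw [← this]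
        ring
    _ = _ := by
        rw [Fintype.sum_prod_type, Finset.sum_mul_sum]
        exact Finset.sum_congr rfl fun x _ => Finset.sum_congr rfl fun s _ => by ring

end Probability

/-! ### Entropy on a finite uniform space -/

section Entropy

open Classical in
/-- Number of elements of the class of `w`. -/
noncomputable def classSize {Ω : Type*} [Fintype Ω] (r : Setoid Ω) (w : Ω) : ℕ :=
  (Finset.univ.filter fun w' => r w w').card

/-- Sum over `w` of the logarithm of the size of the class of `w`.  For a random variable on the
uniform probability space `Ω` whose level sets are the classes of `r`, this is
`|Ω| * (log |Ω| - H)`, where `H` is the Shannon entropy of the variable.  The setoid `r ⊓ r'`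
belongs to the pair of the variables of `r` and `r'`, so
`logSize g - logSize (g ⊓ x)` is `|Ω|` times the conditional entropy of `x` given `g`. -/
noncomputable def logSize {Ω : Type*} [Fintype Ω] (r : Setoid Ω) : ℝ :=
  ∑ w, Real.log (classSize r w)

variable {Ω α : Type*} [Fintype Ω]

lemma classSize_pos (r : Setoid Ω) (w : Ω) : 0 < classSize r w := by
  classical
  exact Finset.card_pos.2 ⟨w, by simp⟩

lemma classSize_congr (r : Setoid Ω) {w w' : Ω} (h : r w w') : classSize r w = classSize r w' := by
  classical
  unfold classSize
  congr 1
  ext v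
  simp only [Finset.mem_filter, Finset.mem_univ, true_and]
  exact ⟨fun hv => r.trans (r.symm h) hv, fun hv => r.trans h hv⟩

lemma classSize_mono {r r' : Setoid Ω} (h : r ≤ r') (w : Ω) : classSize r w ≤ classSize r' w := by
  classical
  refine Finset.card_le_card fun v hv => ?_
  simp only [Finset.mem_filter, Finset.mem_univ, true_and] at hv ⊢
  exact h hv

lemma logSize_mono {r r' : Setoid Ω} (h : r ≤ r') : logSize r ≤ logSize r' :=
  Finset.sum_le_sum fun w _ => Real.log_le_log (by exact_mod_cast classSize_pos r w)
    (by exact_mod_cast classSize_mono h w)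

/-- Gibbs' inequality: the conditional entropy of `f` given `g` is at most the cross entropy with
respect to any conditional sub-distribution `q`. -/
lemma logSize_sub_le [Fintype α] (g : Setoid Ω) (f : Ω → α) (q : Ω → α → ℝ)
    (hq0 : ∀ w a, 0 ≤ q w a) (hqf : ∀ w, 0 < q w (f w)) (hq1 : ∀ w, ∑ a, q w a ≤ 1)
    (hqg : ∀ w w', g w w' → q w = q w') :
    logSize g - logSize (g ⊓ Setoid.ker f) ≤ ∑ w, -Real.log (q w (f w)) := by
  classical
  have hpos : ∀ (r : Setoid Ω) w, (0 : ℝ) < classSize r w := fun r w => by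
    exact_mod_cast classSize_pos r w
  have hpt : ∀ w, Real.log (classSize g w) - Real.log (classSize (g ⊓ Setoid.ker f) w) +
      Real.log (q w (f w)) ≤
      q w (f w) * classSize g w / classSize (g ⊓ Setoid.ker f) w - 1 := by
    intro w
    refine le_trans (le_of_eq ?_) (Real.log_le_sub_one_of_pos
      (div_pos (mul_pos (hqf w) (hpos g w)) (hpos (g ⊓ Setoid.ker f) w)))
    rw [Real.log_div (mul_pos (hqf w) (hpos g w)).ne' (hpos _ w).ne',
      Real.log_mul (hqf w).ne' (hpos g w).ne']
    ring
  have hinner : ∀ w',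
      ∑ w, (if g w' w then q w (f w) / classSize (g ⊓ Setoid.ker f) w else 0) ≤ 1 := by
    intro w'
    calc ∑ w, (if g w' w then q w (f w) / classSize (g ⊓ Setoid.ker f) w else 0)
        = ∑ a, ∑ w with f w = a,
            (if g w' w then q w (f w) / classSize (g ⊓ Setoid.ker f) w else 0) :=
          (Finset.sum_fiberwise _ _ _).symm
      _ ≤ ∑ a, q w' a := by
          refine Finset.sum_le_sum fun a _ => ?_
          rw [← Finset.sum_filter, Finset.filter_filter]
          rcases (Finset.univ.filter fun w => f w = a ∧ g w' w).eq_empty_or_nonempty with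
            h | ⟨v, hv⟩
          · rw [h, Finset.sum_empty]; exact hq0 _ _
          · simp only [Finset.mem_filter, Finset.mem_univ, true_and] at hv
            have hset : (Finset.univ.filter fun w => f w = a ∧ g w' w) =
                Finset.univ.filter fun w => (g ⊓ Setoid.ker f) v w := by
              ext w
              simp only [Finset.mem_filter, Finset.mem_univ, true_and, Setoid.inf_iff_and,
                Setoid.ker_def]
              exact ⟨fun h => ⟨g.trans (g.symm hv.2) h.2, hv.1.trans h.1.symm⟩,
                fun h => ⟨h.2.symm.trans hv.1, g.trans hv.2 h.1⟩⟩
            have hc : ((Finset.univ.filter fun w => f w = a ∧ g w' w).card : ℝ) =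
                classSize (g ⊓ Setoid.ker f) v := by
              rw [hset]; rfl
            rw [Finset.sum_congr rfl (g := fun _ => q w' a / classSize (g ⊓ Setoid.ker f) v)]
            · rw [Finset.sum_const, nsmul_eq_mul, hc, mul_div_cancel₀ _ (hpos _ v).ne']
            · intro w hw
              have hw' := hw
              rw [hset] at hw'
              simp only [Finset.mem_filter, Finset.mem_univ, true_and] at hw hw'
              rw [classSize_congr _ hw', hw.1, hqg _ _ hw.2]
      _ ≤ 1 := hq1 w'
  have htot : ∑ w, q w (f w) * classSize g w / classSize (g ⊓ Setoid.ker f) w ≤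
      ∑ _w : Ω, (1 : ℝ) := by
    calc ∑ w, q w (f w) * classSize g w / classSize (g ⊓ Setoid.ker f) w
        = ∑ w, ∑ w', (if g w' w then q w (f w) / classSize (g ⊓ Setoid.ker f) w else 0) := by
          refine Finset.sum_congr rfl fun w _ => ?_
          rw [← Finset.sum_filter, Finset.sum_const, nsmul_eq_mul]
          have : (Finset.univ.filter fun w' => g w' w).card = classSize g w := by
            unfold classSize
            congr 1
            ext v
            simp only [Finset.mem_filter, Finset.mem_univ, true_and]
            exact ⟨fun h => g.symm h, fun h => g.symm h⟩
          rw [this]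
          ring
      _ = ∑ w', ∑ w, (if g w' w then q w (f w) / classSize (g ⊓ Setoid.ker f) w else 0) :=
          Finset.sum_comm
      _ ≤ _ := Finset.sum_le_sum fun w' _ => hinner w'
  have hsum := Finset.sum_le_sum fun w (_ : w ∈ Finset.univ) => hpt w
  rw [Finset.sum_sub_distrib] at hsum
  simp only [Finset.sum_add_distrib, Finset.sum_sub_distrib] at hsum
  rw [Finset.sum_neg_distrib]
  unfold logSize
  linarith

/-- Conditioning reduces entropy. -/
lemma logSize_sub_le_of_le [Fintype α] {g g' : Setoid Ω} (hg : g' ≤ g) (f : Ω → α) :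
    logSize g' - logSize (g' ⊓ Setoid.ker f) ≤ logSize g - logSize (g ⊓ Setoid.ker f) := by
  classical
  have hpos : ∀ (r : Setoid Ω) w, (0 : ℝ) < classSize r w := fun r w => by
    exact_mod_cast classSize_pos r w
  have hc : ∀ w, ((Finset.univ.filter fun w' => g w w' ∧ f w' = f w).card : ℝ) =
      classSize (g ⊓ Setoid.ker f) w := fun w => by
    unfold classSize
    congr 2
    ext v
    simp only [Finset.mem_filter, Finset.mem_univ, true_and]
    exact ⟨fun h => ⟨h.1, h.2.symm⟩, fun h => ⟨h.1, h.2.symm⟩⟩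
  refine (logSize_sub_le g' f
    (fun w a => ((Finset.univ.filter fun w' => g w w' ∧ f w' = a).card : ℝ) / classSize g w)
    (fun w a => by positivity) (fun w => ?_) (fun w => ?_) fun w w' hw => ?_).trans ?_
  · simp only [hc]
    exact div_pos (hpos _ _) (hpos _ _)
  · rw [← Finset.sum_div, div_le_one (hpos g w)]
    refine le_of_eq ?_
    norm_cast
    unfold classSize
    rw [Finset.card_eq_sum_card_fiberwise (f := f) (t := Finset.univ) fun _ _ => by simp]
    simp_rw [Finset.filter_filter]
  · have h := hg hw
    funext a
    rw [classSize_congr g h]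
    congr 3
    ext v
    simp only [Finset.mem_filter, Finset.mem_univ, true_and]
    exact ⟨fun hv => ⟨g.trans (g.symm h) hv.1, hv.2⟩, fun hv => ⟨g.trans h hv.1, hv.2⟩⟩
  · unfold logSize
    rw [← Finset.sum_sub_distrib]
    refine Finset.sum_le_sum fun w _ => le_of_eq ?_
    simp only [hc]
    rw [Real.log_div (hpos _ _).ne' (hpos _ _).ne']
    ring

/-- Conditional entropy is at most the logarithm of the number of values. -/
lemma logSize_sub_le_log_card [Fintype α] [Nonempty α] (g : Setoid Ω) (f : Ω → α) :
    logSize g - logSize (g ⊓ Setoid.ker f) ≤ Fintype.card Ω * Real.log (Fintype.card α) := by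
  have hα : (0 : ℝ) < Fintype.card α := by exact_mod_cast Fintype.card_pos
  refine (logSize_sub_le g f (fun _ _ => (Fintype.card α : ℝ)⁻¹) (fun _ _ => by positivity)
    (fun _ => by positivity) (fun _ => ?_) fun _ _ _ => rfl).trans (le_of_eq ?_)
  · simp [hα.ne']
  · simp

open Classical in
/-- Fano's inequality for an estimate `φ` of `f` from the variable of `g`.  The binary entropy of
the error probability is replaced by its tangent at `t`, which is affine in the error probability. -/
lemma logSize_sub_le_fano [Fintype α] [Nonempty α] (g : Setoid Ω) (f φ : Ω → α)
    (hφ : ∀ w w', g w w' → φ w = φ w') {t : ℝ} (ht0 : 0 < t) (ht1 : t < 1) :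
    logSize g - logSize (g ⊓ Setoid.ker f) ≤ Fintype.card Ω * (-Real.log (1 - t)) +
      ((Finset.univ.filter fun w => φ w ≠ f w).card : ℝ) *
        (Real.log (Fintype.card α) - Real.log t) := by
  have hα : (0 : ℝ) < Fintype.card α := by exact_mod_cast Fintype.card_pos
  have ht1' : 0 < 1 - t := by linarith
  refine (logSize_sub_le g f (fun w a => if a = φ w then 1 - t else t / Fintype.card α)
    (fun w a => ?_) (fun w => ?_) (fun w => ?_) fun w w' hw => ?_).trans ?_
  · split_ifs <;> positivity
  · split_ifs <;> positivity
  · calc ∑ a, (if a = φ w then 1 - t else t / Fintype.card α)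
        ≤ ∑ a, ((if a = φ w then 1 - t else 0) + t / Fintype.card α) := by
          refine Finset.sum_le_sum fun a _ => ?_
          have : 0 < t / Fintype.card α := by positivity
          split_ifs <;> linarith
      _ = 1 := by
          rw [Finset.sum_add_distrib]
          simp only [Finset.sum_ite_eq', Finset.mem_univ, if_true, Finset.sum_const,
            Finset.card_univ, nsmul_eq_mul]
          field_simp
          ring
  · rw [hφ w w' hw]
  · have hlog : 0 ≤ -Real.log (1 - t) := by
      have := Real.log_nonpos ht1'.le (by linarith)
      linarith
    calc ∑ w, -Real.log (if f w = φ w then 1 - t else t / Fintype.card α)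
        ≤ ∑ w, (-Real.log (1 - t) +
            if φ w ≠ f w then Real.log (Fintype.card α) - Real.log t else 0) := by
          refine Finset.sum_le_sum fun w _ => ?_
          by_cases h : f w = φ w
          · simp [h]
          · rw [if_neg h, if_pos (Ne.symm h), Real.log_div ht0.ne' hα.ne']
            linarith
      _ = _ := by
          rw [Finset.sum_add_distrib, ← Finset.sum_filter, Finset.sum_const, Finset.sum_const,
            nsmul_eq_mul, nsmul_eq_mul, Finset.card_univ]

end Entropy

/-! ### The degraded outer bound -/

section Converse

variable {𝔽 : Type*} {K n : ℕ} {F : Finset (Fin K) → ℕ} {δ : ℝ}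

/-- The random variable consisting of all messages that are intended for some user in `A`. -/
def knownSetoid (𝔽 : Type*) (F : Finset (Fin K) → ℕ) (A : Finset (Fin K)) :
    Setoid (Message 𝔽 F) where
  r w w' := ∀ J, ¬ Disjoint J A → w J = w' J
  iseqv := ⟨fun _ _ _ => rfl, fun h J hJ => (h J hJ).symm,
    fun h h' J hJ => (h J hJ).trans (h' J hJ)⟩

/-- The random variable consisting of what the users in `A` jointly receive in the first `l` slots,
for the state sequence `s`. -/
def receivedSetoid (c : Code 𝔽 K n F) (s : Fin n → Finset (Fin K)) (A : Finset (Fin K)) (l : ℕ) :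
    Setoid (Message 𝔽 F) where
  r w w' := ∀ i : Fin n, (i : ℕ) < l → ¬ Disjoint (s i) A → c.input w s i = c.input w' s i
  iseqv := ⟨fun _ _ _ _ => rfl, fun h i hi hA => (h i hi hA).symm,
    fun h h' i hi hA => (h i hi hA).trans (h' i hi hA)⟩

/-- `|Ω|` times the conditional entropy of the packet sent in slot `l`, given the variable of `U`
and what the users in `A` have received before, for the state sequence `s`. -/
noncomputable def innovation [Fintype 𝔽] (c : Code 𝔽 K n F) (U : Setoid (Message 𝔽 F))
    (A : Finset (Fin K)) (s : Fin n → Finset (Fin K)) (l : Fin n) : ℝ :=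
  logSize (U ⊓ receivedSetoid c s A l) -
    logSize (U ⊓ receivedSetoid c s A l ⊓ Setoid.ker fun w => c.input w s l)

/-- The expected sum of the innovations over all slots. -/
noncomputable def totalInnovation [Fintype 𝔽] (c : Code 𝔽 K n F) (δ : ℝ)
    (U : Setoid (Message 𝔽 F)) (A : Finset (Fin K)) : ℝ :=
  ∑ l, ∑ s, stateProb δ s * innovation c U A s l

lemma past_update (s : Fin n → Finset (Fin K)) {i l : Fin n} (h : i ≤ l) (x : Finset (Fin K)) :
    past (Function.update s l x) i = past s i := by
  funext a
  have : a.castLE i.isLt.le ≠ l := by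
    intro e
    have : (a : ℕ) = l := congrArg Fin.val e
    have := a.isLt
    have : (i : ℕ) ≤ l := h
    omega
  simp [past, Function.update_of_ne this]

lemma input_update (c : Code 𝔽 K n F) (w : Message 𝔽 F) (s : Fin n → Finset (Fin K))
    {i l : Fin n} (h : i ≤ l) (x : Finset (Fin K)) :
    c.input w (Function.update s l x) i = c.input w s i := by
  rw [Code.input, Code.input, past_update s h]

lemma receivedSetoid_update (c : Code 𝔽 K n F) (s : Fin n → Finset (Fin K)) (A : Finset (Fin K))
    (l : Fin n) (x : Finset (Fin K)) :
    receivedSetoid c (Function.update s l x) A l = receivedSetoid c s A l := by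
  ext w w'
  refine forall_congr' fun i => forall_congr' fun hi => ?_
  have hi' : i < l := hi
  rw [input_update c w s hi'.le, input_update c w' s hi'.le, Function.update_of_ne hi'.ne]

variable [Fintype 𝔽]

lemma innovation_update (c : Code 𝔽 K n F) (U : Setoid (Message 𝔽 F)) (A : Finset (Fin K))
    (s : Fin n → Finset (Fin K)) (l : Fin n) (x : Finset (Fin K)) :
    innovation c U A (Function.update s l x) l = innovation c U A s l := by
  simp only [innovation, receivedSetoid_update, input_update c _ s le_rfl]

lemma innovation_nonneg (c : Code 𝔽 K n F) (U : Setoid (Message 𝔽 F)) (A : Finset (Fin K))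
    (s : Fin n → Finset (Fin K)) (l : Fin n) : 0 ≤ innovation c U A s l :=
  sub_nonneg.2 (logSize_mono inf_le_left)

/-- Users that receive more find the packets less informative. -/
lemma innovation_anti (c : Code 𝔽 K n F) (U : Setoid (Message 𝔽 F)) {A A' : Finset (Fin K)}
    (h : A ⊆ A') (s : Fin n → Finset (Fin K)) (l : Fin n) :
    innovation c U A' s l ≤ innovation c U A s l := by
  have hr : receivedSetoid c s A' l ≤ receivedSetoid c s A l := by
    intro w w' hw i hi hA
    exact hw i hi fun hd => hA (Finset.disjoint_of_subset_right h hd)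
  exact logSize_sub_le_of_le (inf_le_inf_left U hr) _

lemma innovation_le [Nonempty 𝔽] (c : Code 𝔽 K n F) (U : Setoid (Message 𝔽 F))
    (A : Finset (Fin K)) (s : Fin n → Finset (Fin K)) (l : Fin n) :
    innovation c U A s l ≤ Fintype.card (Message 𝔽 F) * Real.log (Fintype.card 𝔽) :=
  logSize_sub_le_log_card _ _

lemma totalInnovation_nonneg (h0 : 0 ≤ δ) (h1 : δ ≤ 1) (c : Code 𝔽 K n F)
    (U : Setoid (Message 𝔽 F)) (A : Finset (Fin K)) : 0 ≤ totalInnovation c δ U A :=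
  Finset.sum_nonneg fun l _ => Finset.sum_nonneg fun s _ =>
    mul_nonneg (stateProb_nonneg h0 h1 s) (innovation_nonneg c U A s l)

lemma totalInnovation_anti (h0 : 0 ≤ δ) (h1 : δ ≤ 1) (c : Code 𝔽 K n F)
    (U : Setoid (Message 𝔽 F)) {A A' : Finset (Fin K)} (h : A ⊆ A') :
    totalInnovation c δ U A' ≤ totalInnovation c δ U A :=
  Finset.sum_le_sum fun l _ => Finset.sum_le_sum fun s _ =>
    mul_le_mul_of_nonneg_left (innovation_anti c U h s l) (stateProb_nonneg h0 h1 s)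

lemma totalInnovation_le [Nonempty 𝔽] (h0 : 0 ≤ δ) (h1 : δ ≤ 1) (c : Code 𝔽 K n F)
    (U : Setoid (Message 𝔽 F)) (A : Finset (Fin K)) :
    totalInnovation c δ U A ≤
      n * (Fintype.card (Message 𝔽 F) * Real.log (Fintype.card 𝔽)) := by
  calc totalInnovation c δ U A
      ≤ ∑ _l : Fin n, ∑ s : Fin n → Finset (Fin K), stateProb δ s *
          (Fintype.card (Message 𝔽 F) * Real.log (Fintype.card 𝔽)) :=
        Finset.sum_le_sum fun l _ => Finset.sum_le_sum fun s _ =>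
          mul_le_mul_of_nonneg_left (innovation_le c U A s l) (stateProb_nonneg h0 h1 s)
    _ = _ := by
        simp_rw [← Finset.sum_mul, sum_stateProb]
        simp

/-- Chain rule for what the users in `A` jointly receive. -/
lemma logSize_sub_received (c : Code 𝔽 K n F) (U : Setoid (Message 𝔽 F)) (A : Finset (Fin K))
    (s : Fin n → Finset (Fin K)) :
    logSize U - logSize (U ⊓ receivedSetoid c s A n) =
      ∑ l, (if ¬ Disjoint (s l) A then 1 else 0) * innovation c U A s l := by
  have hstep : ∀ l : Fin n, (if ¬ Disjoint (s l) A then 1 else 0) * innovation c U A s l =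
      logSize (U ⊓ receivedSetoid c s A l) - logSize (U ⊓ receivedSetoid c s A (l + 1)) := by
    intro l
    by_cases h : Disjoint (s l) A
    · have : receivedSetoid c s A (l + 1) = receivedSetoid c s A l := by
        ext w w'
        refine forall_congr' fun i => ⟨fun H hi => H (by omega), fun H hi hA => ?_⟩
        have : i ≠ l := fun e => hA (e ▸ h)
        exact H (by have := Fin.val_ne_of_ne this; omega) hA
      rw [this, if_neg (not_not.2 h)]
      ring
    · have : U ⊓ receivedSetoid c s A l ⊓ Setoid.ker (fun w => c.input w s l) =
          U ⊓ receivedSetoid c s A (l + 1) := by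
        rw [inf_assoc]
        congr 1
        ext w w'
        constructor
        · rintro ⟨H, H'⟩ i hi hA
          rcases eq_or_ne i l with rfl | hne
          · exact H'
          · exact H i (by have := Fin.val_ne_of_ne hne; omega) hA
        · exact fun H => ⟨fun i hi => H i (by omega), H l (by omega) h⟩
      rw [if_pos h, one_mul, innovation, this]
  simp_rw [hstep]
  rw [Fin.sum_univ_eq_sum_range (fun l => logSize (U ⊓ receivedSetoid c s A l) -
    logSize (U ⊓ receivedSetoid c s A (l + 1))), Finset.sum_range_sub']
  congr 2
  exact (inf_eq_left.2 fun w w' _ i hi => absurd hi (Nat.not_lt_zero _)).symm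

/-- With state feedback, the users in `A` get on average the fraction `1 - δ ^ |A|` of the
innovations, since the state of a slot is independent of its innovation. -/
lemma expected_logSize_sub_received (c : Code 𝔽 K n F) (U : Setoid (Message 𝔽 F))
    (A : Finset (Fin K)) :
    ∑ s, stateProb δ s * (logSize U - logSize (U ⊓ receivedSetoid c s A n)) =
      (1 - δ ^ A.card) * totalInnovation c δ U A := by
  have hp : ∑ x : Finset (Fin K), slotProb δ x * (if ¬ Disjoint x A then (1 : ℝ) else 0) =
      1 - δ ^ A.card := by
    have h := sum_slotProb_indicator (δ := δ) ∅ A (by simp)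
    simp only [Finset.empty_subset, true_and, Finset.card_empty, pow_zero, one_mul] at h
    rw [← h, eq_sub_iff_add_eq, ← Finset.sum_add_distrib]
    refine Eq.trans ?_ (sum_slotProb (K := K) (δ := δ))
    refine Finset.sum_congr rfl fun x _ => ?_
    by_cases hx : Disjoint x A <;> simp [hx]
  simp_rw [logSize_sub_received, Finset.mul_sum]
  rw [Finset.sum_comm, totalInnovation, Finset.mul_sum]
  refine Finset.sum_congr rfl fun l _ => ?_
  rw [sum_stateProb_mul_indep l (fun x => if ¬ Disjoint x A then (1 : ℝ) else 0)
    (fun s => innovation c U A s l) fun s x => innovation_update c U A s l x, hp]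

lemma classSize_known (A : Finset (Fin K)) (w : Message 𝔽 F) :
    classSize (knownSetoid 𝔽 F A) w =
      Fintype.card 𝔽 ^ ∑ J with Disjoint J A, F J := by
  classical
  have : (Finset.univ.filter fun w' => knownSetoid 𝔽 F A w w') =
      Fintype.piFinset fun J => if Disjoint J A then Finset.univ else {w J} := by
    ext w'
    simp only [Finset.mem_filter, Finset.mem_univ, true_and, Fintype.mem_piFinset]
    refine forall_congr' fun J => ?_
    by_cases h : Disjoint J A
    · simp [h]
    · simp [h, eq_comm]
  unfold classSize
  rw [this, Fintype.card_piFinset, ← Finset.prod_pow_eq_pow_sum, Finset.prod_filter]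
  refine Finset.prod_congr rfl fun J _ => ?_
  by_cases h : Disjoint J A <;> simp [h]

lemma logSize_known (A : Finset (Fin K)) :
    logSize (knownSetoid 𝔽 F A) = Fintype.card (Message 𝔽 F) *
      ((∑ J with Disjoint J A, (F J : ℝ)) * Real.log (Fintype.card 𝔽)) := by
  simp [logSize, classSize_known]

/-- The cost of conveying to user `k` the messages that are not intended for any user in `A`, when
the users in `insert k A` cooperate and the messages for `A` are known. -/
lemma totalInnovation_sub_ge [Nonempty 𝔽] (h0 : 0 ≤ δ) (h1 : δ ≤ 1) (c : Code 𝔽 K n F)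
    (A : Finset (Fin K)) (k : Fin K) {t : ℝ} (ht0 : 0 < t) (ht1 : t < 1)
    (herr : c.errorProb δ k ≤ t) :
    Fintype.card (Message 𝔽 F) *
      ((1 - t) * ((∑ J with k ∈ J ∧ Disjoint J A, (F J : ℝ)) * Real.log (Fintype.card 𝔽)) -
        (-Real.log (1 - t) - t * Real.log t)) ≤
    (1 - δ ^ (insert k A).card) *
      (totalInnovation c δ (knownSetoid 𝔽 F A) (insert k A) -
        totalInnovation c δ (knownSetoid 𝔽 F (insert k A)) (insert k A)) := by
  classical
  set Ω := Message 𝔽 F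
  set M : ℝ := (∑ J with k ∈ J ∧ Disjoint J A, (F J : ℝ)) * Real.log (Fintype.card 𝔽) with hM
  have hlogq : 0 ≤ Real.log (Fintype.card 𝔽) := Real.log_natCast_nonneg _
  have hM0 : 0 ≤ M := mul_nonneg (Finset.sum_nonneg fun _ _ => Nat.cast_nonneg _) hlogq
  have hlogt : 0 ≤ -Real.log t := by
    have := Real.log_nonpos ht0.le ht1.le
    linarith
  let f : Ω → ((J : {J : Finset (Fin K) // k ∈ J ∧ Disjoint J A}) → Fin (F J) → 𝔽) :=
    fun w J => w J
  have hinf : knownSetoid 𝔽 F A ⊓ Setoid.ker f = knownSetoid 𝔽 F (insert k A) := by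
    ext w w'
    rw [Setoid.inf_iff_and, Setoid.ker_def]
    constructor
    · rintro ⟨H, H'⟩ J hJ
      by_cases hA : Disjoint J A
      · exact congrFun H' ⟨J, by rw [Finset.disjoint_insert_right] at hJ; tauto, hA⟩
      · exact H J hA
    · intro H
      refine ⟨fun J hJ => H J fun h => hJ (Finset.disjoint_insert_right.1 h).2, ?_⟩
      funext J
      exact H J fun h => (Finset.disjoint_insert_right.1 h).1 J.2.1
  have hlogcard : Real.log (Fintype.card
      ((J : {J : Finset (Fin K) // k ∈ J ∧ Disjoint J A}) → Fin (F J) → 𝔽)) = M := by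
    rw [Fintype.card_pi]
    simp only [Fintype.card_pi, Finset.prod_const, Finset.card_univ, Fintype.card_fin]
    rw [Finset.prod_pow_eq_pow_sum, Nat.cast_pow, Real.log_pow, hM, Nat.cast_sum]
    congr 1
    exact (Finset.sum_subtype _ (by simp) (fun J => (F J : ℝ))).symm
  have hdiff : logSize (knownSetoid 𝔽 F A) - logSize (knownSetoid 𝔽 F (insert k A)) =
      Fintype.card Ω * M := by
    rw [logSize_known, logSize_known, hM, ← mul_sub, ← sub_mul]
    congr 2
    rw [sub_eq_iff_eq_add, ← Finset.sum_filter_add_sum_filter_not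
      (Finset.univ.filter fun J => Disjoint J A) (fun J => k ∈ J), Finset.filter_filter,
      Finset.filter_filter]
    simp_rw [Finset.disjoint_insert_right, and_comm]
  have hfano : ∀ s, logSize (knownSetoid 𝔽 F A ⊓ receivedSetoid c s (insert k A) n) -
      logSize (knownSetoid 𝔽 F (insert k A) ⊓ receivedSetoid c s (insert k A) n) ≤
      Fintype.card Ω * (-Real.log (1 - t)) +
        ((Finset.univ.filter fun w => c.Err k w s).card : ℝ) * (M - Real.log t) := by
    intro s
    have hφ : ∀ w w', (knownSetoid 𝔽 F A ⊓ receivedSetoid c s (insert k A) n) w w' →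
        (fun (J : {J : Finset (Fin K) // k ∈ J ∧ Disjoint J A}) =>
          c.dec k (c.output k w s) s ⟨J, J.2.1⟩) =
        fun (J : {J : Finset (Fin K) // k ∈ J ∧ Disjoint J A}) =>
          c.dec k (c.output k w' s) s ⟨J, J.2.1⟩ := by
      rintro w w' ⟨-, H⟩
      have : c.output k w s = c.output k w' s := by
        funext i
        unfold Code.output
        split_ifs with hi
        · rw [H i i.isLt (Finset.not_disjoint_iff.2 ⟨k, hi, Finset.mem_insert_self _ _⟩)]
        · rfl
      rw [this]
    have h := logSize_sub_le_fano (knownSetoid 𝔽 F A ⊓ receivedSetoid c s (insert k A) n) f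
      (fun w (J : {J : Finset (Fin K) // k ∈ J ∧ Disjoint J A}) =>
        c.dec k (c.output k w s) s ⟨J, J.2.1⟩) hφ ht0 ht1
    rw [hlogcard, inf_right_comm, hinf] at h
    refine h.trans (add_le_add_right (mul_le_mul_of_nonneg_right ?_ (by linarith)) _)
    norm_cast
    refine Finset.card_le_card fun w hw => ?_
    simp only [Finset.mem_filter, Finset.mem_univ, true_and] at hw ⊢
    obtain ⟨J, hJ⟩ := Function.ne_iff.1 hw
    exact ⟨⟨J, J.2.1⟩, hJ⟩
  have hΩ : (0 : ℝ) < Fintype.card Ω := by exact_mod_cast Fintype.card_pos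
  have herr' : ∑ s, stateProb δ s * ((Finset.univ.filter fun w => c.Err k w s).card : ℝ) ≤
      Fintype.card Ω * t := by
    have : ∑ s, stateProb δ s * ((Finset.univ.filter fun w => c.Err k w s).card : ℝ) =
        Fintype.card Ω * c.errorProb δ k := by
      rw [Code.errorProb, Finset.mul_sum]
      refine Finset.sum_congr rfl fun s _ => ?_
      field_simp
      congr!
    rw [this]
    exact mul_le_mul_of_nonneg_left herr hΩ.le
  rw [mul_sub (1 - _), ← expected_logSize_sub_received, ← expected_logSize_sub_received,
    ← Finset.sum_sub_distrib]
  have hpt : ∀ s : Fin n → Finset (Fin K), stateProb δ s * (Fintype.card Ω * M -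
      Fintype.card Ω * (-Real.log (1 - t))) -
      (stateProb δ s * ((Finset.univ.filter fun w => c.Err k w s).card : ℝ)) * (M - Real.log t) ≤
      stateProb δ s * (logSize (knownSetoid 𝔽 F A) -
        logSize (knownSetoid 𝔽 F A ⊓ receivedSetoid c s (insert k A) n)) -
      stateProb δ s * (logSize (knownSetoid 𝔽 F (insert k A)) -
        logSize (knownSetoid 𝔽 F (insert k A) ⊓ receivedSetoid c s (insert k A) n)) := by
    intro s
    have e1 := mul_le_mul_of_nonneg_left (hfano s) (stateProb_nonneg h0 h1 s)
    have e2 := congrArg (stateProb δ s * ·) hdiff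
    linarith
  refine le_trans ?_ (Finset.sum_le_sum fun s _ => hpt s)
  rw [Finset.sum_sub_distrib, ← Finset.sum_mul, ← Finset.sum_mul, sum_stateProb]
  have := mul_le_mul_of_nonneg_right herr' (by linarith : 0 ≤ M - Real.log t)
  linarith

/-- The outer bound for the degraded broadcast channel in which the users cooperate in the order
given by `π`, for codes with error probability at most `t`. -/
lemma degraded_bound_of_code [Nonempty 𝔽] (h0 : 0 ≤ δ) (h1 : δ < 1) (c : Code 𝔽 K n F)
    (π : Equiv.Perm (Fin K)) {t : ℝ} (ht0 : 0 < t) (ht1 : t < 1)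
    (herr : ∀ k, c.errorProb δ k ≤ t) :
    ∑ i : Fin K, ((1 - t) * ((∑ J with π.symm i ∈ J ∧ ∀ u ∈ J, i ≤ π u, (F J : ℝ)) *
        Real.log (Fintype.card 𝔽)) - (-Real.log (1 - t) - t * Real.log t)) /
          (1 - δ ^ ((i : ℕ) + 1)) ≤
      n * Real.log (Fintype.card 𝔽) := by
  classical
  have hΩ : (0 : ℝ) < Fintype.card (Message 𝔽 F) := by exact_mod_cast Fintype.card_pos
  let A : ℕ → Finset (Fin K) := fun m => Finset.univ.filter fun u => (π u : ℕ) < m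
  have hcard : ∀ m ≤ K, (A m).card = m := by
    intro m hm
    rw [← Finset.card_map π.toEmbedding]
    have : (A m).map π.toEmbedding = Finset.univ.filter fun v : Fin K => (v : ℕ) < m := by
      ext v
      simp [A, Finset.mem_map_equiv]
    rw [this, Fin.card_filter_val_lt, min_eq_right hm]
  set a : Fin K → ℝ := fun i => ((1 - t) *
    ((∑ J with π.symm i ∈ J ∧ ∀ u ∈ J, i ≤ π u, (F J : ℝ)) *
        Real.log (Fintype.card 𝔽)) - (-Real.log (1 - t) - t * Real.log t)) /
          (1 - δ ^ ((i : ℕ) + 1)) with ha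
  have hstep : ∀ i : Fin K, Fintype.card (Message 𝔽 F) * a i ≤
      totalInnovation c δ (knownSetoid 𝔽 F (A i)) (A (i + 1)) -
        totalInnovation c δ (knownSetoid 𝔽 F (A (i + 1))) (A (i + 1)) := by
    intro i
    have hins : A (i + 1) = insert (π.symm i) (A i) := by
      ext u
      simp only [A, Finset.mem_filter, Finset.mem_univ, true_and, Finset.mem_insert,
        Equiv.eq_symm_apply, Fin.ext_iff]
      omega
    have hpos : 0 < 1 - δ ^ ((i : ℕ) + 1) := sub_pos.2 (pow_lt_one₀ h0 h1 (by omega))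
    have h := totalInnovation_sub_ge h0 h1.le c (A i) (π.symm i) ht0 ht1 (herr _)
    rw [← hins, hcard _ (by omega)] at h
    have hset : (Finset.univ.filter fun J => π.symm i ∈ J ∧ Disjoint J (A i)) =
        Finset.univ.filter fun J => π.symm i ∈ J ∧ ∀ u ∈ J, i ≤ π u := by
      ext J
      simp only [Finset.mem_filter, Finset.mem_univ, true_and, Finset.disjoint_left, A, not_lt,
        Fin.le_def]
    rw [hset] at h
    rw [ha]
    simp only
    rw [← mul_div_assoc, div_le_iff₀ hpos]
    linarith
  have hind : ∀ m (hm : m ≤ K), Fintype.card (Message 𝔽 F) * ∑ i : Fin m, a (i.castLE hm) ≤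
      n * (Fintype.card (Message 𝔽 F) * Real.log (Fintype.card 𝔽)) -
        totalInnovation c δ (knownSetoid 𝔽 F (A m)) (A m) := by
    intro m
    induction m with
    | zero =>
      intro hm
      have := totalInnovation_le h0 h1.le c (knownSetoid 𝔽 F (A 0)) (A 0)
      simp only [Finset.univ_eq_empty, Finset.sum_empty, mul_zero]
      linarith
    | succ m ih =>
      intro hm
      rw [Fin.sum_univ_castSucc, mul_add]
      have h2 := ih (by omega)
      have h3 := hstep ⟨m, hm⟩
      have h4 := totalInnovation_anti h0 h1.le c (knownSetoid 𝔽 F (A m))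
        (show A m ⊆ A (m + 1) from fun u hu => by
          simp only [A, Finset.mem_filter, Finset.mem_univ, true_and] at hu ⊢; omega)
      have e1 : (Fin.last m).castLE hm = ⟨m, hm⟩ := rfl
      have e2 : ∀ i : Fin m, (i.castSucc).castLE hm = i.castLE (by omega) := fun _ => rfl
      rw [e1]
      simp_rw [e2]
      simp only at h3
      linarith
  have h := hind K le_rfl
  have hn := totalInnovation_nonneg h0 h1.le c (knownSetoid 𝔽 F (A K)) (A K)
  simp only [Fin.castLE_rfl, id] at h
  have h5 : Fintype.card (Message 𝔽 F) * ∑ i, a i ≤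
      Fintype.card (Message 𝔽 F) * (n * Real.log (Fintype.card 𝔽)) := by linarith
  exact le_of_mul_le_mul_left h5 hΩ

end Converse

/-! ### Averaging over the orders of the users -/

section SumBound

variable {𝔽 : Type*} [Fintype 𝔽] {K j : ℕ} {δ : ℝ}

/-- Every achievable tuple satisfies the outer bound of the degraded broadcast channel for each
order `π` of the users. -/
lemma degraded_bound [Nontrivial 𝔽] (h0 : 0 ≤ δ) (h1 : δ < 1) {R : Finset (Fin K) → ℝ}
    (hR : Achievable 𝔽 K j δ R) (π : Equiv.Perm (Fin K)) :
    ∑ i : Fin K, (∑ J with J.card = j ∧ π.symm i ∈ J ∧ ∀ u ∈ J, i ≤ π u, R J) /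
      (1 - δ ^ ((i : ℕ) + 1)) ≤ 1 := by
  set a : Fin K → ℝ := fun i => ∑ J with J.card = j ∧ π.symm i ∈ J ∧ ∀ u ∈ J, i ≤ π u, R J
  set L := Real.log (Fintype.card 𝔽)
  have hL : 0 < L := Real.log_pos (by exact_mod_cast Fintype.one_lt_card)
  have hpos : ∀ i : Fin K, 0 < 1 - δ ^ ((i : ℕ) + 1) := fun i =>
    sub_pos.2 (pow_lt_one₀ h0 h1 (by omega))
  -- The bound for error probability `t`, normalized; the order-`j` bound is its limit as `t → 0`.
  let φ : ℝ → ℝ := fun t => ∑ i, ((1 - t) * a i - (-Real.log (1 - t) - t * Real.log t) / L) /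
    (1 - δ ^ ((i : ℕ) + 1))
  have hφ : ∀ t, 0 < t → t < 1 → φ t ≤ 1 := by
    intro t ht0 ht1
    obtain ⟨n, F, c, hn, herr, hrate⟩ := hR.2 t ht0
    have h := degraded_bound_of_code h0 h1 c π ht0 ht1 fun k => (herr k).le
    have hn' : (1 : ℝ) ≤ n := by exact_mod_cast hn
    have hc : 0 ≤ -Real.log (1 - t) - t * Real.log t := by
      have h2 := Real.log_nonpos (by linarith : 0 ≤ 1 - t) (by linarith)
      have h3 := mul_nonpos_of_nonneg_of_nonpos ht0.le (Real.log_nonpos ht0.le ht1.le)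
      linarith
    have hnL : 0 < n * L := by positivity
    refine le_of_mul_le_mul_left (le_trans ?_ (h.trans_eq (mul_one _).symm)) hnL
    rw [Finset.mul_sum]
    refine Finset.sum_le_sum fun i _ => ?_
    rw [← mul_div_assoc]
    refine div_le_div_of_nonneg_right ?_ (hpos i).le
    have ha : n * a i ≤ ∑ J with π.symm i ∈ J ∧ ∀ u ∈ J, i ≤ π u, (F J : ℝ) := by
      rw [Finset.mul_sum]
      calc ∑ J with J.card = j ∧ π.symm i ∈ J ∧ ∀ u ∈ J, i ≤ π u, n * R J
          ≤ ∑ J with J.card = j ∧ π.symm i ∈ J ∧ ∀ u ∈ J, i ≤ π u, (F J : ℝ) := by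
            refine Finset.sum_le_sum fun J hJ => ?_
            have := hrate J (Finset.mem_filter.1 hJ).2.1
            rw [lt_div_iff₀ (by linarith)] at this
            linarith
        _ ≤ _ := Finset.sum_le_sum_of_subset_of_nonneg (fun J hJ => by
            simp only [Finset.mem_filter, Finset.mem_univ, true_and] at hJ ⊢
            exact hJ.2) fun _ _ _ => Nat.cast_nonneg _
    have h4 : n * L * ((1 - t) * a i - (-Real.log (1 - t) - t * Real.log t) / L) =
        (1 - t) * ((n * a i) * L) - n * (-Real.log (1 - t) - t * Real.log t) := by
      field_simp
    rw [h4]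
    have h5 := mul_le_mul_of_nonneg_left (mul_le_mul_of_nonneg_right ha hL.le)
      (by linarith : 0 ≤ 1 - t)
    have h6 := mul_le_mul_of_nonneg_right hn' hc
    linarith
  have hcont : ContinuousAt φ 0 := by
    have hlog : ContinuousAt (fun t : ℝ => Real.log (1 - t)) 0 :=
      ContinuousAt.log (by fun_prop) (by norm_num)
    have hmul : ContinuousAt (fun t : ℝ => t * Real.log t) 0 :=
      Real.continuous_mul_log.continuousAt
    refine tendsto_finsetSum _ fun i _ => ?_
    exact ContinuousAt.div_const (((by fun_prop : ContinuousAt (fun t : ℝ => (1 - t) * a i) 0)).sub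
      ((hlog.neg.sub hmul).div_const _)) _
  have h00 : φ 0 = ∑ i : Fin K, a i / (1 - δ ^ ((i : ℕ) + 1)) := by
    simp [φ]
  rw [← h00]
  refine le_of_tendsto (hcont.tendsto.mono_left (nhdsWithin_le_nhds (s := Set.Ioi 0))) ?_
  filter_upwards [Ioo_mem_nhdsGT (zero_lt_one' ℝ)] with t ht
  exact hφ t ht.1 ht.2

/-- Number of `j`-subsets whose first element is `i`. -/
lemma card_min_eq (hj : 1 ≤ j) (i : Fin K) :
    (Finset.univ.filter fun J : Finset (Fin K) => J.card = j ∧ i ∈ J ∧ ∀ u ∈ J, i ≤ u).card =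
      (K - (i + 1)).choose (j - 1) := by
  have hI : (Finset.Ioi i).card = K - (i + 1) := by rw [Fin.card_Ioi]; omega
  rw [← hI, ← Finset.card_powersetCard]
  refine Finset.card_nbij' (fun J => J.erase i) (fun J => insert i J) ?_ ?_ ?_ ?_
  · intro J hJ
    simp only [Finset.coe_filter, Finset.mem_univ, true_and, Set.mem_ofPred_eq] at hJ
    rw [Finset.mem_coe, Finset.mem_powersetCard]
    refine ⟨fun u hu => ?_, by rw [Finset.card_erase_of_mem hJ.2.1, hJ.1]⟩
    rw [Finset.mem_erase] at hu
    exact Finset.mem_Ioi.2 (lt_of_le_of_ne (hJ.2.2 u hu.2) hu.1.symm)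
  · intro J hJ
    have hJ' := Finset.mem_powersetCard.1 hJ
    have hi : i ∉ J := fun h => lt_irrefl _ (Finset.mem_Ioi.1 (hJ'.1 h))
    simp only [Finset.coe_filter, Finset.mem_univ, true_and, Set.mem_ofPred_eq]
    refine ⟨by rw [Finset.card_insert_of_notMem hi, hJ'.2]; omega, Finset.mem_insert_self _ _, ?_⟩
    intro u hu
    rcases Finset.mem_insert.1 hu with rfl | hu
    · exact le_rfl
    · exact (Finset.mem_Ioi.1 (hJ'.1 hu)).le
  · intro J hJ
    simp only [Finset.coe_filter, Finset.mem_univ, true_and, Set.mem_ofPred_eq] at hJ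
    exact Finset.insert_erase hJ.2.1
  · intro J hJ
    have hJ' := Finset.mem_powersetCard.1 hJ
    exact Finset.erase_insert fun h => lt_irrefl _ (Finset.mem_Ioi.1 (hJ'.1 h))

lemma exists_perm_map_eq {J J' : Finset (Fin K)} (h : J.card = J'.card) :
    ∃ σ : Equiv.Perm (Fin K), ∀ u, σ u ∈ J' ↔ u ∈ J := by
  classical
  let e : {u // u ∈ J} ≃ {u // u ∈ J'} := Finset.equivOfCardEq h
  refine ⟨e.extendSubtype, fun u => ⟨fun hu => ?_, fun hu => e.extendSubtype_mem u hu⟩⟩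
  by_contra hn
  exact e.extendSubtype_not_mem u hn hu

/-- Averaging over all orders of the users: the weight `f` of the first user of a `j`-subset has the
same average for all `j`-subsets. -/
lemma sum_perm_min_weight (hj : 1 ≤ j) (f : Fin K → ℝ) {J₀ : Finset (Fin K)} (hJ₀ : J₀.card = j) :
    (K.choose j : ℝ) * ∑ π : Equiv.Perm (Fin K), ∑ i,
        (if π.symm i ∈ J₀ ∧ ∀ u ∈ J₀, i ≤ π u then f i else 0) =
      K.factorial * ∑ i : Fin K, ((K - (i + 1)).choose (j - 1) : ℝ) * f i := by
  have hconst : ∀ J ∈ (Finset.univ : Finset (Fin K)).powersetCard j,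
      ∑ π : Equiv.Perm (Fin K), ∑ i, (if π.symm i ∈ J₀ ∧ ∀ u ∈ J₀, i ≤ π u then f i else 0) =
      ∑ π : Equiv.Perm (Fin K), ∑ i, (if π.symm i ∈ J ∧ ∀ u ∈ J, i ≤ π u then f i else 0) := by
    intro J hJ
    obtain ⟨σ, hσ⟩ := exists_perm_map_eq (hJ₀.trans (Finset.mem_powersetCard.1 hJ).2.symm)
    refine Fintype.sum_equiv (Equiv.mulRight σ⁻¹) _ _ fun π => ?_
    refine Finset.sum_congr rfl fun i _ => if_congr (and_congr ?_ ?_) rfl rfl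
    · rw [← hσ]
      simp [Equiv.Perm.mul_def, Equiv.Perm.inv_def]
    · constructor
      · intro h u hu
        have := h (σ⁻¹ u) ((hσ _).1 (by simpa using hu))
        simpa using this
      · intro h u hu
        have := h (σ u) ((hσ _).2 hu)
        simpa using this
  have hcard : ((Finset.univ : Finset (Fin K)).powersetCard j).card = K.choose j := by simp
  rw [← hcard, ← nsmul_eq_mul, ← Finset.sum_const, Finset.sum_congr rfl hconst, Finset.sum_comm]
  have hπ : ∀ π : Equiv.Perm (Fin K), ∑ J ∈ (Finset.univ : Finset (Fin K)).powersetCard j,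
      ∑ i, (if π.symm i ∈ J ∧ ∀ u ∈ J, i ≤ π u then f i else 0) =
      ∑ i : Fin K, ((K - (i + 1)).choose (j - 1) : ℝ) * f i := by
    intro π
    rw [Finset.sum_comm]
    refine Finset.sum_congr rfl fun i _ => ?_
    rw [← Finset.sum_filter, Finset.sum_const, nsmul_eq_mul, ← card_min_eq hj]
    congr 2
    refine Finset.card_equiv (Equiv.finsetCongr π) fun J => ?_
    simp only [Finset.mem_filter, Finset.mem_powersetCard, Finset.subset_univ, true_and,
      Finset.mem_univ, Equiv.finsetCongr_apply, Finset.card_map, Finset.mem_map_equiv]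
    refine and_congr_right fun _ => and_congr_right fun _ => ?_
    constructor
    · intro h u hu
      simpa using h _ hu
    · intro h u hu
      exact h _ (by simpa using hu)
  simp_rw [hπ]
  rw [Finset.sum_const, Finset.card_univ, Fintype.card_perm, Fintype.card_fin, nsmul_eq_mul]

lemma sum_fin_choose_eq (hj : 1 ≤ j) (hjK : j ≤ K) (f : ℕ → ℝ) :
    ∑ i : Fin K, ((K - (i + 1)).choose (j - 1) : ℝ) * f (i + 1) =
      ∑ k ∈ Finset.Icc 1 (K - j + 1), ((K - k).choose (j - 1) : ℝ) * f k := by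
  rw [Fin.sum_univ_eq_sum_range (fun i => ((K - (i + 1)).choose (j - 1) : ℝ) * f (i + 1))]
  have h1 : ∑ k ∈ Finset.Icc 1 (K - j + 1), ((K - k).choose (j - 1) : ℝ) * f k =
      ∑ k ∈ Finset.Icc 1 K, ((K - k).choose (j - 1) : ℝ) * f k := by
    refine Finset.sum_subset (Finset.Icc_subset_Icc le_rfl (by omega)) fun k hk hk' => ?_
    rw [Finset.mem_Icc] at hk hk'
    rw [Nat.choose_eq_zero_of_lt (by omega), Nat.cast_zero, zero_mul]
  rw [h1]
  refine Finset.sum_nbij' (fun i => i + 1) (fun k => k - 1) ?_ ?_ ?_ ?_ fun _ _ => rfl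
  all_goals
    intro k hk
    simp at hk ⊢
    try omega

lemma orderBound_denom_pos (hjK : j ≤ K) (h0 : 0 ≤ δ) (h1 : δ < 1) :
    0 < ∑ k ∈ Finset.Icc 1 (K - j + 1), ((K - k).choose (j - 1) : ℝ) / (1 - δ ^ k) := by
  refine Finset.sum_pos' (fun k hk => ?_) ⟨K - j + 1, by simp, ?_⟩
  · exact div_nonneg (Nat.cast_nonneg _) (sub_nonneg.2 (pow_le_one₀ h0 h1.le))
  · refine div_pos (by exact_mod_cast Nat.choose_pos (by omega))
      (sub_pos.2 (pow_lt_one₀ h0 h1 (by omega)))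

theorem sumRate_le_orderBound [Nontrivial 𝔽] (hj : 1 ≤ j) (hjK : j ≤ K) (h0 : 0 ≤ δ) (h1 : δ < 1)
    {R : Finset (Fin K) → ℝ} (hR : Achievable 𝔽 K j δ R) :
    sumRate K j R ≤ orderBound K j δ := by
  set D := ∑ k ∈ Finset.Icc 1 (K - j + 1), ((K - k).choose (j - 1) : ℝ) / (1 - δ ^ k) with hD
  have hDpos : 0 < D := orderBound_denom_pos hjK h0 h1
  let f : Fin K → ℝ := fun i => 1 / (1 - δ ^ ((i : ℕ) + 1))
  have hDf : ∑ i : Fin K, ((K - (i + 1)).choose (j - 1) : ℝ) * f i = D := by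
    rw [hD, sum_fin_choose_eq hj hjK fun k => 1 / (1 - δ ^ k)]
    exact Finset.sum_congr rfl fun k _ => mul_one_div _ _
  have hsum : ∑ π : Equiv.Perm (Fin K), ∑ i : Fin K,
      (∑ J with J.card = j ∧ π.symm i ∈ J ∧ ∀ u ∈ J, i ≤ π u, R J) /
      (1 - δ ^ ((i : ℕ) + 1)) ≤ K.factorial := by
    refine (Finset.sum_le_sum fun π _ => degraded_bound h0 h1 hR π).trans (le_of_eq ?_)
    rw [Finset.sum_const, Finset.card_univ, Fintype.card_perm, Fintype.card_fin, nsmul_eq_mul,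
      mul_one]
  have hswap : ∑ π : Equiv.Perm (Fin K), ∑ i : Fin K,
      (∑ J with J.card = j ∧ π.symm i ∈ J ∧ ∀ u ∈ J, i ≤ π u, R J) /
      (1 - δ ^ ((i : ℕ) + 1)) =
      ∑ J ∈ (Finset.univ : Finset (Fin K)).powersetCard j, R J * ∑ π : Equiv.Perm (Fin K), ∑ i,
        (if π.symm i ∈ J ∧ ∀ u ∈ J, i ≤ π u then f i else 0) := by
    simp_rw [Finset.mul_sum]
    conv_rhs => rw [Finset.sum_comm]
    refine Finset.sum_congr rfl fun π _ => ?_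
    conv_rhs => rw [Finset.sum_comm]
    refine Finset.sum_congr rfl fun i _ => ?_
    have : (Finset.univ.filter fun J : Finset (Fin K) =>
        J.card = j ∧ π.symm i ∈ J ∧ ∀ u ∈ J, i ≤ π u) =
        ((Finset.univ : Finset (Fin K)).powersetCard j).filter fun J =>
          π.symm i ∈ J ∧ ∀ u ∈ J, i ≤ π u := by
      ext J
      simp [Finset.mem_powersetCard]
    rw [this, Finset.sum_filter, Finset.sum_div]
    refine Finset.sum_congr rfl fun J _ => ?_
    split_ifs <;> simp [f, div_eq_mul_inv]
  have hC : (0 : ℝ) < K.choose j := by exact_mod_cast Nat.choose_pos hjK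
  have hfac : (0 : ℝ) < K.factorial := by exact_mod_cast Nat.factorial_pos K
  rw [hswap] at hsum
  rw [orderBound, ← hD, le_div_iff₀ hDpos, sumRate]
  refine le_of_mul_le_mul_left ?_ hfac
  have e : K.factorial * ((∑ J ∈ (Finset.univ : Finset (Fin K)).powersetCard j, R J) * D) =
      K.choose j * ∑ J ∈ (Finset.univ : Finset (Fin K)).powersetCard j, R J *
        ∑ π : Equiv.Perm (Fin K), ∑ i,
        (if π.symm i ∈ J ∧ ∀ u ∈ J, i ≤ π u then f i else 0) := by
    rw [Finset.sum_mul, Finset.mul_sum, Finset.mul_sum]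
    refine Finset.sum_congr rfl fun J hJ => ?_
    have := sum_perm_min_weight hj f (Finset.mem_powersetCard.1 hJ).2
    rw [hDf] at this
    linear_combination (-R J) * this
  rw [e, mul_comm (K.factorial : ℝ)]
  exact mul_le_mul_of_nonneg_left hsum hC.le

end SumBound

/-! ### The total length of the algorithm -/

section Identity

variable {K j : ℕ} {δ : ℝ}

lemma subphaseLength_of_lt {m : ℕ} (h : m < j) : subphaseLength K j δ m = 0 := by
  rw [subphaseLength, if_neg h.ne, Finset.sum_eq_zero, zero_div]
  intro l _
  rw [if_neg (by have := l.isLt; omega)]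

lemma subphaseLength_nonneg (h0 : 0 ≤ δ) (h1 : δ ≤ 1) (m : ℕ) : 0 ≤ subphaseLength K j δ m := by
  induction m using Nat.strong_induction_on with
  | _ m ih =>
    rw [subphaseLength]
    refine div_nonneg ?_ (sub_nonneg.2 (pow_le_one₀ h0 h1))
    split_ifs
    · exact zero_le_one
    · refine Finset.sum_nonneg fun l _ => ?_
      split_ifs
      · have := ih l l.isLt
        have : 0 ≤ 1 - δ := by linarith
        positivity
      · exact le_rfl

/-- The recursion for the sub-phase lengths, with all phases on the right-hand side and phases
counted from `0`. -/
lemma subphaseLength_succ (hj : 1 ≤ j) (h0 : 0 ≤ δ) (h1 : δ < 1) {p : ℕ} (hp : p < K) :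
    subphaseLength K j δ (p + 1) = (if p + 1 = j then 1 else 0) +
      δ ^ (K - p) * ∑ i ∈ Finset.range (p + 1),
        (p.choose i : ℝ) * (1 - δ) ^ (p - i) * subphaseLength K j δ (i + 1) := by
  have hK : K - (p + 1) + 1 = K - p := by omega
  have hpos : 0 < 1 - δ ^ (K - p) := sub_pos.2 (pow_lt_one₀ h0 h1 (by omega))
  have hsum : (if p + 1 = j then (1 : ℝ) else ∑ l : Fin (p + 1), if j ≤ (l : ℕ) then
      ((p + 1 - 1).choose ((l : ℕ) - 1) : ℝ) *
        (subphaseLength K j δ (l : ℕ) * δ ^ (K - (p + 1) + 1) * (1 - δ) ^ (p + 1 - (l : ℕ)))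
      else 0) = (if p + 1 = j then 1 else 0) + δ ^ (K - p) * ∑ i ∈ Finset.range p,
        (p.choose i : ℝ) * (1 - δ) ^ (p - i) * subphaseLength K j δ (i + 1) := by
    have hR : ∀ i, ¬ j ≤ i + 1 → (p.choose i : ℝ) * (1 - δ) ^ (p - i) *
        subphaseLength K j δ (i + 1) = 0 := fun i hi => by
      rw [subphaseLength_of_lt (by omega), mul_zero]
    by_cases h : p + 1 = j
    · rw [if_pos h, if_pos h, Finset.sum_eq_zero, mul_zero, add_zero]
      intro i hi
      have := Finset.mem_range.1 hi
      exact hR i (by omega)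
    · rw [if_neg h, if_neg h, zero_add, Fin.sum_univ_eq_sum_range (fun l => if j ≤ l then
        ((p + 1 - 1).choose (l - 1) : ℝ) *
          (subphaseLength K j δ l * δ ^ (K - (p + 1) + 1) * (1 - δ) ^ (p + 1 - l)) else 0),
        Finset.sum_range_succ', if_neg (by omega), add_zero, Finset.mul_sum]
      refine Finset.sum_congr rfl fun i _ => ?_
      by_cases hi : j ≤ i + 1
      · rw [if_pos hi, hK, Nat.add_sub_cancel, Nat.add_sub_cancel, Nat.add_sub_add_right]
        ring
      · rw [if_neg hi, hR i hi, mul_zero]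
  have hrec : subphaseLength K j δ (p + 1) * (1 - δ ^ (K - p)) =
      (if p + 1 = j then 1 else 0) + δ ^ (K - p) * ∑ i ∈ Finset.range p,
        (p.choose i : ℝ) * (1 - δ) ^ (p - i) * subphaseLength K j δ (i + 1) := by
    rw [← hsum, subphaseLength, hK, div_mul_cancel₀ _ hpos.ne']
  rw [Finset.sum_range_succ, Nat.choose_self, Nat.sub_self, pow_zero, Nat.cast_one]
  linarith

/-- Composition of two binomial transforms. -/
lemma sum_choose_mul_sum_choose (x y : ℝ) (f : ℕ → ℝ) (p : ℕ) :
    ∑ i ∈ Finset.range (p + 1), (p.choose i : ℝ) * x ^ (p - i) *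
      ∑ r ∈ Finset.range (i + 1), (i.choose r : ℝ) * y ^ (i - r) * f r =
    ∑ r ∈ Finset.range (p + 1), (p.choose r : ℝ) * (y + x) ^ (p - r) * f r := by
  have h1 : ∀ i ∈ Finset.range (p + 1), (p.choose i : ℝ) * x ^ (p - i) *
      ∑ r ∈ Finset.range (i + 1), (i.choose r : ℝ) * y ^ (i - r) * f r =
      ∑ r ∈ Finset.range (p + 1), if r ≤ i then
        (p.choose i : ℝ) * (i.choose r : ℝ) * (x ^ (p - i) * y ^ (i - r)) * f r else 0 := by
    intro i hi
    have hi' := Finset.mem_range.1 hi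
    rw [← Finset.sum_filter, Finset.mul_sum]
    have : (Finset.range (p + 1)).filter (fun r => r ≤ i) = Finset.range (i + 1) := by
      ext r; simp; omega
    rw [this]
    exact Finset.sum_congr rfl fun r _ => by ring
  rw [Finset.sum_congr rfl h1, Finset.sum_comm]
  refine Finset.sum_congr rfl fun r hr => ?_
  have hr' : r ≤ p := Nat.lt_succ_iff.1 (Finset.mem_range.1 hr)
  rw [← Finset.sum_filter, add_pow, Finset.mul_sum, Finset.sum_mul]
  refine Finset.sum_nbij' (fun i => i - r) (fun i => i + r) ?_ ?_ ?_ ?_ ?_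
  · intro i hi; simp at hi ⊢; omega
  · intro i hi; simp at hi ⊢; omega
  · intro i hi; simp at hi ⊢; omega
  · intro i hi; simp
  · intro i hi
    have hi' : i < p + 1 ∧ r ≤ i := by simpa using hi
    have hc : (p.choose i : ℝ) * (i.choose r : ℝ) = p.choose r * (p - r).choose (i - r) := by
      exact_mod_cast Nat.choose_mul (n := p) hi'.2
    have hsub : p - r - (i - r) = p - i := by omega
    rw [hc, hsub]
    ring

/-- The binomial transform of the sub-phase lengths.  For a group `A` of `K - p` users and `k ∈ A`,
the left-hand side is the total length of the sub-phases `J` with `J ∩ A = {k}`.  The fraction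
`1 - δ ^ |A|` of these slots reaches `A`, and the identity says that they are just as many as the
message packets of the `j`-subsets `J` with `J ∩ A = {k}`. -/
lemma sum_choose_mul_subphaseLength (hj : 1 ≤ j) (h0 : 0 ≤ δ) (h1 : δ < 1) {p : ℕ} (hp : p < K) :
    ∑ i ∈ Finset.range (p + 1), (p.choose i : ℝ) * subphaseLength K j δ (i + 1) =
      (p.choose (j - 1) : ℝ) / (1 - δ ^ (K - p)) := by
  have hpos : ∀ p, p < K → 0 < 1 - δ ^ (K - p) := fun p hp =>
    sub_pos.2 (pow_lt_one₀ h0 h1 (by omega))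
  let g : ℕ → ℝ := fun p => (p.choose (j - 1) : ℝ) / (1 - δ ^ (K - p))
  let b : ℕ → ℝ := fun p => ∑ r ∈ Finset.range (p + 1), (p.choose r : ℝ) * (-1) ^ (p - r) * g r
  -- The inverse transform `b` of `g` satisfies the recursion of the sub-phase lengths.
  have hb : ∀ p, p < K → b p = (if p + 1 = j then 1 else 0) +
      δ ^ (K - p) * ∑ i ∈ Finset.range (p + 1), (p.choose i : ℝ) * (1 - δ) ^ (p - i) * b i := by
    intro p hp
    have e1 := sum_choose_mul_sum_choose (1 - δ) (-1) g p
    have e2 : (-1 : ℝ) + (1 - δ) = (-1) * δ := by ring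
    rw [e1, e2, ← sub_eq_iff_eq_add, Finset.mul_sum, ← Finset.sum_sub_distrib]
    have e3 : ∀ r ∈ Finset.range (p + 1), (p.choose r : ℝ) * (-1) ^ (p - r) * g r -
        δ ^ (K - p) * ((p.choose r : ℝ) * ((-1) * δ) ^ (p - r) * g r) =
        (p.choose r : ℝ) * (-1) ^ (p - r) * ∑ i ∈ Finset.range (r + 1),
          (r.choose i : ℝ) * 1 ^ (r - i) * (if i = j - 1 then 1 else 0) := by
      intro r hr
      have hr' : r ≤ p := Nat.lt_succ_iff.1 (Finset.mem_range.1 hr)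
      have hg : g r * (1 - δ ^ (K - r)) = r.choose (j - 1) :=
        div_mul_cancel₀ _ (hpos r (by omega)).ne'
      have hs : ∑ i ∈ Finset.range (r + 1),
          (r.choose i : ℝ) * 1 ^ (r - i) * (if i = j - 1 then 1 else 0) = r.choose (j - 1) := by
        simp only [one_pow, mul_one, mul_ite, mul_zero, Finset.sum_ite_eq', Finset.mem_range]
        split_ifs with h
        · rfl
        · rw [Nat.choose_eq_zero_of_lt (by omega), Nat.cast_zero]
      have hpow : δ ^ (K - r) = δ ^ (K - p) * δ ^ (p - r) := by
        rw [← pow_add]; congr 1; omega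
      rw [hs, ← hg, hpow, mul_pow]
      ring
    rw [Finset.sum_congr rfl e3, sum_choose_mul_sum_choose, Finset.sum_eq_single p]
    · simp only [Nat.choose_self, Nat.sub_self, pow_zero, Nat.cast_one, one_mul]
      exact if_congr (by omega) rfl rfl
    · intro r hr hrp
      have hr' := Finset.mem_range.1 hr
      rw [show (1 : ℝ) + -1 = 0 by ring, zero_pow (by omega)]
      ring
    · simp
  have heq : ∀ p, p < K → subphaseLength K j δ (p + 1) = b p := by
    intro p
    induction p using Nat.strong_induction_on with
    | _ p ih =>
      intro hp
      have r1 := subphaseLength_succ (δ := δ) hj h0 h1 hp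
      have r2 := hb p hp
      rw [Finset.sum_range_succ] at r1 r2
      rw [Finset.sum_congr rfl fun i hi => by
        rw [ih i (Finset.mem_range.1 hi) (by have := Finset.mem_range.1 hi; omega)]] at r1
      simp only [Nat.choose_self, Nat.sub_self, pow_zero, Nat.cast_one, one_mul] at r1 r2
      have h3 : (subphaseLength K j δ (p + 1) - b p) * (1 - δ ^ (K - p)) = 0 := by
        linear_combination r1 - r2
      rcases mul_eq_zero.1 h3 with h | h
      · linarith
      · exact absurd h (hpos p hp).ne'
  have h4 := sum_choose_mul_sum_choose 1 (-1) g p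
  rw [Finset.sum_congr rfl fun i hi => by
    rw [heq i (by have := Finset.mem_range.1 hi; omega)]]
  simp only [one_pow, mul_one] at h4
  rw [h4, Finset.sum_eq_single p]
  · simp [g]
  · intro r hr hrp
    have hr' := Finset.mem_range.1 hr
    rw [show (-1 : ℝ) + 1 = 0 by ring, zero_pow (by omega)]
    ring
  · simp

/-- Total length of the algorithm per packet of each order-`j` message. -/
lemma sum_choose_mul_subphaseLength_eq (hj : 1 ≤ j) (hjK : j ≤ K) (h0 : 0 ≤ δ) (h1 : δ < 1) :
    ∑ m ∈ Finset.range (K + 1), (K.choose m : ℝ) * subphaseLength K j δ m =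
      ∑ k ∈ Finset.Icc 1 (K - j + 1), ((K - k).choose (j - 1) : ℝ) / (1 - δ ^ k) := by
  have hock : ∀ i, ∑ p ∈ Finset.range K, (p.choose i : ℝ) = K.choose (i + 1) := by
    intro i
    clear hjK
    induction K with
    | zero => simp
    | succ K ih => rw [Finset.sum_range_succ, ih, Nat.choose_succ_succ, Nat.cast_add, add_comm]
  rw [Finset.sum_range_succ', subphaseLength_of_lt (by omega), mul_zero, add_zero]
  simp_rw [← hock, Finset.sum_mul]
  rw [Finset.sum_comm]
  have e1 : ∀ p ∈ Finset.range K, ∑ i ∈ Finset.range K,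
      (p.choose i : ℝ) * subphaseLength K j δ (i + 1) =
      (p.choose (j - 1) : ℝ) / (1 - δ ^ (K - p)) := by
    intro p hp
    have hp' := Finset.mem_range.1 hp
    rw [← sum_choose_mul_subphaseLength hj h0 h1 hp']
    refine (Finset.sum_subset (fun i hi => ?_) fun i _ hi => ?_).symm
    · simp at hi ⊢; omega
    · rw [Nat.choose_eq_zero_of_lt (by simpa using hi), Nat.cast_zero, zero_mul]
  rw [Finset.sum_congr rfl e1]
  symm
  refine Finset.sum_subset_zero_on_sdiff (s₂ := Finset.Icc 1 K) (fun k hk => ?_) (fun k hk => ?_)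
    (fun k hk => rfl) |>.trans ?_
  · simp at hk ⊢; omega
  · simp only [Finset.mem_sdiff, Finset.mem_Icc] at hk
    rw [Nat.choose_eq_zero_of_lt (by omega), Nat.cast_zero, zero_div]
  · refine Finset.sum_nbij' (fun k => K - k) (fun p => K - p) ?_ ?_ ?_ ?_ ?_
    · intro k hk; simp at hk ⊢; omega
    · intro k hk; simp at hk ⊢; omega
    · intro k hk; simp at hk ⊢; omega
    · intro k hk; simp at hk ⊢; omega
    · intro k hk
      have : K - (K - k) = k := by simp at hk; omega
      rw [this]

end Identity

/-! ### The multi-phase code and its decoding -/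

section Scheme

variable {K n j : ℕ} {F : Finset (Fin K) → ℕ}

/-- Every choice of sub-phase lengths has a time table. -/
lemma exists_isSchedule (j : ℕ) (T : ℕ → ℕ)
    (hn : n = ∑ J : Finset (Fin K), if j ≤ J.card then T J.card else 0) :
    ∃ sub : Fin n → Finset (Fin K), IsSchedule j T sub := by
  classical
  let T' : Finset (Fin K) → ℕ := fun J => if j ≤ J.card then T J.card else 0
  have hcard : Fintype.card (Fin n) = Fintype.card ((J : Finset (Fin K)) × Fin (T' J)) := by
    rw [Fintype.card_sigma, Fintype.card_fin, hn]
    simp [T']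
  let e : Fin n ≃ (J : Finset (Fin K)) × Fin (T' J) := Fintype.equivOfCardEq hcard
  -- An injective key that sorts the subsets by cardinality.
  let κ : Finset (Fin K) → ℕ ×ₗ Fin (Fintype.card (Finset (Fin K))) := fun J =>
    toLex (J.card, Fintype.equivFin _ J)
  have hκ : Function.Injective κ := fun J J' h =>
    (Fintype.equivFin _).injective (congrArg Prod.snd (toLex.injective h))
  let σ := Tuple.sort fun l => κ (e l).1
  have hmono : Monotone fun l => κ (e (σ l)).1 := Tuple.monotone_sort fun l => κ (e l).1
  refine ⟨fun l => (e (σ l)).1, ⟨fun a b hab => ?_, fun a b c hab hbc hac => ?_, fun J => ?_⟩⟩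
  · exact Prod.Lex.monotone_fst _ _ (hmono hab)
  · refine hκ (le_antisymm ?_ (hmono hab))
    refine (hmono hbc).trans (le_of_eq ?_)
    simp only [hac]
  · have : (Finset.univ.filter fun l => (e (σ l)).1 = J).card =
        (Finset.univ.filter fun p : (J : Finset (Fin K)) × Fin (T' J) => p.1 = J).card :=
      Finset.card_equiv (σ.trans e) fun l => by simp
    rw [this]
    have h2 : (Finset.univ.filter fun p : (J : Finset (Fin K)) × Fin (T' J) => p.1 = J) =
        Finset.univ.map (Function.Embedding.sigmaMk J) := by
      ext ⟨J', i⟩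
      simp only [Finset.mem_filter, Finset.mem_univ, true_and, Finset.mem_map,
        Function.Embedding.sigmaMk_apply]
      constructor
      · rintro rfl
        exact ⟨i, rfl⟩
      · rintro ⟨i', h⟩
        exact (congrArg Sigma.fst h).symm
    rw [h2, Finset.card_map, Finset.card_univ, Fintype.card_fin]

lemma IsSchedule.lt_of_ssubset {T : ℕ → ℕ} {sub : Fin n → Finset (Fin K)}
    (h : IsSchedule j T sub) {i l : Fin n} (hil : sub i ⊂ sub l) : i < l := by
  by_contra hn
  exact absurd (h.phases_in_order l i (not_lt.1 hn)) (not_le.2 (Finset.card_lt_card hil))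

lemma IsSchedule.le_card {T : ℕ → ℕ} {sub : Fin n → Finset (Fin K)}
    (h : IsSchedule j T sub) (l : Fin n) : j ≤ (sub l).card := by
  by_contra hn
  have h2 := h.length (sub l)
  rw [if_neg hn, Finset.card_eq_zero] at h2
  exact absurd (h2 ▸ Finset.mem_filter.2 ⟨Finset.mem_univ l, rfl⟩) (Finset.notMem_empty l)

/-- A packet sent in sub-phase `I` and received exactly by the users in `x` is available to
sub-phase `J`. -/
def Overheard (I J x : Finset (Fin K)) : Prop := I ⊂ J ∧ J \ I ⊆ x ∧ x ⊆ J ∧ ¬ I ⊆ x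

lemma Overheard.exists_eq_union {I J x : Finset (Fin K)} (h : Overheard I J x) :
    ∃ I' ⊂ I, x = (J \ I) ∪ I' := by
  obtain ⟨-, h1, h2, h3⟩ := h
  refine ⟨x ∩ I, Finset.ssubset_iff_subset_ne.2
    ⟨Finset.inter_subset_right, fun e => h3 (Finset.inter_eq_right.1 e)⟩, ?_⟩
  ext u
  have hu1 : u ∈ J \ I → u ∈ x := fun hu => h1 hu
  have hu2 : u ∈ x → u ∈ J := fun hu => h2 hu
  simp only [Finset.mem_sdiff, Finset.mem_union, Finset.mem_inter] at hu1 ⊢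
  tauto

/-- The packets that may enter a linear combination: message packets, and the packets sent in the
`n` slots. -/
abbrev Source (F : Finset (Fin K) → ℕ) (n : ℕ) : Type := PacketIndex F ⊕ Fin n

/-- The source `a` is available to sub-phase `J`. -/
def IsAvailable (j : ℕ) (sub s : Fin n → Finset (Fin K)) (J : Finset (Fin K)) :
    Source F n → Prop
  | .inl d => J.card = j ∧ d.1 = J
  | .inr i => j < J.card ∧ Overheard (sub i) J (s i)

variable {𝔽 : Type*} [Field 𝔽]

open Classical in
/-- Coefficients over the message packets of the packet sent in slot `l`, as a function of the past
states, when `g l` is the table of coefficients over the sources that slot `l` uses. -/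
noncomputable def schemeCoef (j : ℕ) (sub : Fin n → Finset (Fin K))
    (g : Fin n → Source F n → 𝔽) (l : Fin n) (p : Fin (l : ℕ) → Finset (Fin K)) :
    PacketIndex F → 𝔽 :=
  (∑ d : PacketIndex F, if (sub l).card = j ∧ d.1 = sub l then
      g l (.inl d) • Pi.single d (1 : 𝔽) else 0) +
    ∑ i : Fin n, if h : i < l then
      if j < (sub l).card ∧ Overheard (sub i) (sub l) (p ⟨i, h⟩) then
        g l (.inr i) • schemeCoef j sub g i (fun a => p ⟨a, a.isLt.trans h⟩) else 0
      else 0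
termination_by l

/-- The coefficient vector of a source over the message packets, for the state sequence `s`. -/
noncomputable def sourceVec (j : ℕ) (sub : Fin n → Finset (Fin K)) (g : Fin n → Source F n → 𝔽)
    (s : Fin n → Finset (Fin K)) : Source F n → PacketIndex F → 𝔽
  | .inl d => Pi.single d 1
  | .inr i => schemeCoef j sub g i (past s i)

open Classical in
lemma schemeCoef_past {T : ℕ → ℕ} {sub : Fin n → Finset (Fin K)} (hsub : IsSchedule j T sub)
    (g : Fin n → Source F n → 𝔽) (s : Fin n → Finset (Fin K)) (l : Fin n) :
    schemeCoef j sub g l (past s l) =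
      ∑ a, if IsAvailable j sub s (sub l) a then g l a • sourceVec j sub g s a else 0 := by
  rw [Fintype.sum_sum_type, schemeCoef]
  refine congrArg₂ _ (Finset.sum_congr rfl fun d _ => if_congr Iff.rfl rfl rfl)
    (Finset.sum_congr rfl fun i _ => ?_)
  by_cases h : i < l
  · rw [dif_pos h]
    exact if_congr Iff.rfl rfl rfl
  · rw [dif_neg h, if_neg]
    rintro ⟨-, h2⟩
    exact h (hsub.lt_of_ssubset h2.1)

lemma sourceVec_mem_available {sub : Fin n → Finset (Fin K)} (g : Fin n → Source F n → 𝔽)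
    (s : Fin n → Finset (Fin K)) {J : Finset (Fin K)} {a : Source F n}
    (ha : IsAvailable j sub s J a) :
    sourceVec j sub g s a ∈
      available j sub s (fun l' => schemeCoef j sub g l' (past s l')) J := by
  rcases a with ⟨I, i⟩ | i
  · obtain ⟨h1, h2⟩ := ha
    dsimp only at h2
    subst h2
    exact Or.inl ⟨h1, i, rfl⟩
  · exact Or.inr ⟨ha.1, i, ha.2.1, ha.2.exists_eq_union, rfl⟩

open Classical in
/-- The code with the given encoder in which every receiver picks some message that is consistent
with its observations. -/
noncomputable def consistentCode (enc : (l : Fin n) → Message 𝔽 F →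
    (Fin (l : ℕ) → Finset (Fin K)) → 𝔽) : Code 𝔽 K n F where
  enc := enc
  dec k y s J := if h : ∃ w : Message 𝔽 F,
    (fun l => if k ∈ s l then some (enc l w (past s l)) else none) = y then h.choose J else 0

lemma exists_of_err_consistentCode {enc : (l : Fin n) → Message 𝔽 F →
    (Fin (l : ℕ) → Finset (Fin K)) → 𝔽} {k : Fin K} {w : Message 𝔽 F}
    {s : Fin n → Finset (Fin K)} (h : (consistentCode enc).Err k w s) :
    ∃ w' : Message 𝔽 F, (∀ l, k ∈ s l → enc l w' (past s l) = enc l w (past s l)) ∧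
      ∃ J, k ∈ J ∧ w' J ≠ w J := by
  obtain ⟨J, hJ⟩ := h
  have hex : ∃ w' : Message 𝔽 F,
      (fun l => if k ∈ s l then some (enc l w' (past s l)) else none) =
        (consistentCode enc).output k w s := ⟨w, rfl⟩
  refine ⟨hex.choose, fun l hl => ?_, J, J.2, ?_⟩
  · have := congrFun hex.choose_spec l
    simpa [Code.output, hl, Code.input, consistentCode] using this
  · have h2 : (consistentCode enc).dec k ((consistentCode enc).output k w s) s J =
        hex.choose J := by
      simp only [consistentCode] at hex ⊢
      rw [dif_pos hex]
    rwa [h2] at hJ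

/-- The code of the multi-phase algorithm with coefficient table `g`. -/
noncomputable def schemeCode (j : ℕ) (sub : Fin n → Finset (Fin K))
    (g : Fin n → Source F n → 𝔽) : Code 𝔽 K n F :=
  consistentCode fun l w p => ∑ d : PacketIndex F, schemeCoef j sub g l p d * w d.1 d.2

lemma isMultiphase_schemeCode {T : ℕ → ℕ} {sub : Fin n → Finset (Fin K)}
    (hsub : IsSchedule j T sub) (g : Fin n → Source F n → 𝔽) :
    IsMultiphase (schemeCode j sub g) j T := by
  classical
  refine ⟨sub, schemeCoef j sub g, hsub, fun _ _ _ => rfl, fun s l => ?_⟩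
  rw [schemeCoef_past hsub]
  refine Submodule.sum_mem _ fun a _ => ?_
  split_ifs with ha
  · exact Submodule.smul_mem _ _ (Submodule.subset_span (sourceVec_mem_available g s ha))
  · exact Submodule.zero_mem _

open Classical in
/-- The sources available to sub-phase `J` that user `k` has not received. -/
noncomputable def unknownSources (F : Finset (Fin K) → ℕ) (j : ℕ) (sub s : Fin n → Finset (Fin K))
    (k : Fin K) (J : Finset (Fin K)) : Finset (Source F n) :=
  Finset.univ.filter fun a => IsAvailable j sub s J a ∧ ∀ i, a = .inr i → k ∉ s i

open Classical in
/-- The slots of sub-phase `J` whose packets user `k` gets to know, at once or in a later sub-phase: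
those received by `k` or by some user outside `J`. -/
noncomputable def usefulSlots (sub s : Fin n → Finset (Fin K)) (k : Fin K) (J : Finset (Fin K)) :
    Finset (Fin n) :=
  Finset.univ.filter fun l => sub l = J ∧ (k ∈ s l ∨ ¬ s l ⊆ J)

/-- The submatrix of `g` with the given rows and columns has full column rank. -/
def FullRank {A : Type*} [Fintype A] (g : Fin n → A → 𝔽) (rows : Finset (Fin n))
    (cols : Finset A) : Prop :=
  ∀ y : A → 𝔽, (∀ a ∉ cols, y a = 0) → (∀ l ∈ rows, ∑ a, g l a * y a = 0) → y = 0

/-- Decoding by downward induction on the sub-phases: a packet of sub-phase `J` that user `k` missed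
and some user outside `J` received is available to a later sub-phase. -/
lemma eq_zero_of_fullRank {T : ℕ → ℕ} {sub : Fin n → Finset (Fin K)} (hsub : IsSchedule j T sub)
    (g : Fin n → Source F n → 𝔽) (s : Fin n → Finset (Fin K)) (k : Fin K)
    (hg : ∀ J, k ∈ J → j ≤ J.card →
      FullRank g (usefulSlots sub s k J) (unknownSources F j sub s k J))
    (z : PacketIndex F → 𝔽)
    (hz : ∀ l, k ∈ s l → ∑ d, schemeCoef j sub g l (past s l) d * z d = 0)
    (J : Finset (Fin K)) (hkJ : k ∈ J) (hJ : j ≤ J.card) (a : Source F n)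
    (ha : IsAvailable j sub s J a) : ∑ d, sourceVec j sub g s a d * z d = 0 := by
  classical
  induction hm : K - J.card using Nat.strong_induction_on generalizing J a with
  | _ m ih =>
    set y : Source F n → 𝔽 := fun a => ∑ d, sourceVec j sub g s a d * z d with hy
    have hknown : ∀ a, IsAvailable j sub s J a → a ∉ unknownSources F j sub s k J → y a = 0 := by
      intro a ha hu
      simp only [unknownSources, Finset.mem_filter, Finset.mem_univ, true_and, ha] at hu
      push Not at hu
      obtain ⟨i, rfl, hi⟩ := hu
      exact hz i hi
    have hrow : ∀ l, sub l = J → y (.inr l) =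
        ∑ a, g l a * (if a ∈ unknownSources F j sub s k J then y a else 0) := by
      intro l hl
      calc y (.inr l) = ∑ d, (∑ a, if IsAvailable j sub s (sub l) a then
              g l a • sourceVec j sub g s a else 0) d * z d := by
            simp only [hy]
            rw [← schemeCoef_past hsub]
            rfl
        _ = ∑ a, if IsAvailable j sub s J a then g l a * y a else 0 := by
            simp_rw [Finset.sum_apply, Finset.sum_mul]
            rw [Finset.sum_comm, hl]
            refine Finset.sum_congr rfl fun a _ => ?_
            split_ifs
            · simp only [Pi.smul_apply, smul_eq_mul, hy, Finset.mul_sum, mul_assoc]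
            · simp
        _ = _ := by
            refine Finset.sum_congr rfl fun a _ => ?_
            by_cases hav : IsAvailable j sub s J a
            · rw [if_pos hav]
              by_cases hu : a ∈ unknownSources F j sub s k J
              · rw [if_pos hu]
              · rw [if_neg hu, hknown a hav hu]
            · rw [if_neg hav, if_neg, mul_zero]
              exact fun hu => hav (Finset.mem_filter.1 hu).2.1
    have hzero := hg J hkJ hJ (fun a => if a ∈ unknownSources F j sub s k J then y a else 0)
      (fun a ha => if_neg ha) fun l hl => by
        obtain ⟨hlJ, hl⟩ := (Finset.mem_filter.1 hl).2
        rw [← hrow l hlJ]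
        by_cases hk : k ∈ s l
        · exact hz l hk
        · have hout := hl.resolve_left hk
          have hss : J ⊂ J ∪ s l := Finset.ssubset_iff_subset_ne.2
            ⟨Finset.subset_union_left, fun e => hout (e ▸ Finset.subset_union_right)⟩
          have hcard := Finset.card_lt_card hss
          have hle : (J ∪ s l).card ≤ K := by simpa using Finset.card_le_univ (J ∪ s l)
          refine ih (K - (J ∪ s l).card) (by omega) (J ∪ s l) (Finset.mem_union_left _ hkJ)
            (by omega) (.inr l) ⟨by omega, hlJ ▸ hss, ?_, Finset.subset_union_right, ?_⟩ rfl
          · rw [hlJ, Finset.union_sdiff_left]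
            exact Finset.sdiff_subset
          · rw [hlJ]
            exact fun h => hk (h hkJ)
    by_cases hu : a ∈ unknownSources F j sub s k J
    · have := congrFun hzero a
      simpa [hu] using this
    · exact hknown a ha hu

/-- Receiver `k` makes no error when all the coefficient submatrices it needs have full rank. -/
lemma not_err_schemeCode {N : ℕ} {T : ℕ → ℕ} {sub : Fin n → Finset (Fin K)}
    (hsub : IsSchedule j T sub) (g : Fin n → Source (orderLengths j N) n → 𝔽)
    (s : Fin n → Finset (Fin K)) (k : Fin K)
    (hg : ∀ J, k ∈ J → j ≤ J.card →
      FullRank g (usefulSlots sub s k J) (unknownSources (orderLengths j N) j sub s k J))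
    (w : Message 𝔽 (orderLengths j N)) : ¬ (schemeCode j sub g).Err k w s := by
  intro h
  obtain ⟨w', hw', J, hkJ, hJ⟩ := exists_of_err_consistentCode h
  apply hJ
  funext i
  have hcard : J.card = j := by
    by_contra hne
    have : orderLengths j N J = 0 := if_neg hne
    exact (Fin.cast this i).elim0
  have := eq_zero_of_fullRank hsub g s k hg (fun d => w' d.1 d.2 - w d.1 d.2)
    (fun l hl => by
      simp_rw [mul_sub, Finset.sum_sub_distrib]
      exact sub_eq_zero.2 (hw' l hl)) J hkJ hcard.ge (.inl ⟨J, i⟩) ⟨hcard, rfl⟩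
  rw [Finset.sum_eq_single ⟨J, i⟩] at this
  · simpa [sourceVec, sub_eq_zero] using this
  · intro d _ hd
    simp [sourceVec, hd]
  · simp

end Scheme

section RandomMatrix

variable {𝔽 A : Type*} [Field 𝔽] [Fintype 𝔽] [Fintype A] [DecidableEq A] {n : ℕ}

open Classical in
lemma card_orthogonal_mul (y : A → 𝔽) (hy : y ≠ 0) :
    (Finset.univ.filter fun x : A → 𝔽 => ∑ a, x a * y a = 0).card * Fintype.card 𝔽 =
      Fintype.card (A → 𝔽) := by
  let φ : (A → 𝔽) →+ 𝔽 :=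
    { toFun := fun x => ∑ a, x a * y a
      map_zero' := by simp
      map_add' := fun x x' => by simp [add_mul, Finset.sum_add_distrib] }
  obtain ⟨b, hb⟩ := Function.ne_iff.1 hy
  have hb' : y b ≠ 0 := hb
  have hsurj : ∀ c, c ∈ Set.range φ := fun c => ⟨Pi.single b (c / y b), by
    change ∑ a, (Pi.single b (c / y b) : A → 𝔽) a * y a = c
    rw [Finset.sum_eq_single b]
    · simp [hb']
    · intro a _ ha
      simp [ha]
    · simp⟩
  have hfib : ∀ c, (Finset.univ.filter fun x => φ x = c).card =
      (Finset.univ.filter fun x => φ x = 0).card := fun c =>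
    AddMonoidHom.card_fiber_eq_of_mem_range φ (hsurj c) (hsurj 0)
  have htot := Finset.card_eq_sum_card_fiberwise (s := (Finset.univ : Finset (A → 𝔽))) (f := φ)
    (t := Finset.univ) fun _ _ => by simp
  rw [Finset.sum_congr rfl fun c _ => hfib c, Finset.sum_const, Finset.card_univ,
    Finset.card_univ, smul_eq_mul, mul_comm] at htot
  exact htot.symm

open Classical in
/-- A uniformly random matrix has a rank-deficient submatrix with probability at most
`q ^ (columns - rows)`. -/
lemma card_not_fullRank_mul_le (rows : Finset (Fin n)) (cols : Finset A) :
    (Finset.univ.filter fun g : Fin n → A → 𝔽 => ¬ FullRank g rows cols).card *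
      Fintype.card 𝔽 ^ rows.card ≤
    Fintype.card 𝔽 ^ cols.card * Fintype.card (Fin n → A → 𝔽) := by
  -- Union bound over the nonzero vectors supported on `cols`.
  let Y : Finset (A → 𝔽) := Fintype.piFinset fun a => if a ∈ cols then Finset.univ else {0}
  have hY : Y.card = Fintype.card 𝔽 ^ cols.card := by
    rw [Fintype.card_piFinset]
    simp [apply_ite Finset.card]
  have hone : ∀ y ∈ Y.filter (· ≠ 0),
      (Finset.univ.filter fun g : Fin n → A → 𝔽 => ∀ l ∈ rows, ∑ a, g l a * y a = 0).card *
        Fintype.card 𝔽 ^ rows.card = Fintype.card (Fin n → A → 𝔽) := by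
    intro y hy
    have hset : (Finset.univ.filter fun g : Fin n → A → 𝔽 => ∀ l ∈ rows, ∑ a, g l a * y a = 0) =
        Fintype.piFinset fun l => if l ∈ rows then
          Finset.univ.filter fun x : A → 𝔽 => ∑ a, x a * y a = 0 else Finset.univ := by
      ext g
      simp only [Finset.mem_filter, Finset.mem_univ, true_and, Fintype.mem_piFinset]
      refine forall_congr' fun l => ?_
      split_ifs with h <;> simp [h]
    have hpow : Fintype.card 𝔽 ^ rows.card =
        ∏ l : Fin n, if l ∈ rows then Fintype.card 𝔽 else 1 := by
      simp
    rw [hset, Fintype.card_piFinset, hpow, ← Finset.prod_mul_distrib,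
      Fintype.card_pi (α := fun _ : Fin n => A → 𝔽)]
    refine Finset.prod_congr rfl fun l _ => ?_
    split_ifs
    · exact card_orthogonal_mul y (Finset.mem_filter.1 hy).2
    · rw [mul_one, Finset.card_univ]
  have hsub : (Finset.univ.filter fun g : Fin n → A → 𝔽 => ¬ FullRank g rows cols) ⊆
      (Y.filter (· ≠ 0)).biUnion fun y =>
        Finset.univ.filter fun g : Fin n → A → 𝔽 => ∀ l ∈ rows, ∑ a, g l a * y a = 0 := by
    intro g hg
    have hg' := (Finset.mem_filter.1 hg).2
    unfold FullRank at hg'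
    push Not at hg'
    obtain ⟨y, h1, h2, h3⟩ := hg'
    refine Finset.mem_biUnion.2 ⟨y, Finset.mem_filter.2 ⟨?_, h3⟩, by simpa using h2⟩
    refine Fintype.mem_piFinset.2 fun a => ?_
    split_ifs with ha
    · simp
    · simpa using h1 a ha
  calc _ ≤ (∑ y ∈ Y.filter (· ≠ 0), (Finset.univ.filter fun g : Fin n → A → 𝔽 =>
          ∀ l ∈ rows, ∑ a, g l a * y a = 0).card) * Fintype.card 𝔽 ^ rows.card :=
        Nat.mul_le_mul_right _ ((Finset.card_le_card hsub).trans Finset.card_biUnion_le)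
    _ = (Y.filter (· ≠ 0)).card * Fintype.card (Fin n → A → 𝔽) := by
        rw [Finset.sum_mul, Finset.sum_congr rfl hone, Finset.sum_const, smul_eq_mul]
    _ ≤ _ := by
        rw [← hY]
        exact Nat.mul_le_mul_right _ (Finset.card_filter_le _ _)

open Classical in
/-- Exponential form of the bound on rank deficiency, useful for any sign of `rows - columns`. -/
lemma card_not_fullRank_le_exp (rows : Finset (Fin n)) (cols : Finset A) {t : ℝ} (ht0 : 0 ≤ t)
    (ht : t ≤ Real.log 2) :
    ((Finset.univ.filter fun g : Fin n → A → 𝔽 => ¬ FullRank g rows cols).card : ℝ) ≤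
      Real.exp (-t * ((rows.card : ℝ) - cols.card)) * Fintype.card (Fin n → A → 𝔽) := by
  have hG : (0 : ℝ) < Fintype.card (Fin n → A → 𝔽) := by exact_mod_cast Fintype.card_pos
  rcases le_total (cols.card : ℝ) rows.card with h | h
  · have hq : (2 : ℝ) ≤ Fintype.card 𝔽 := by exact_mod_cast Fintype.one_lt_card (α := 𝔽)
    have hq0 : (0 : ℝ) < Fintype.card 𝔽 := by linarith
    have hlog : t ≤ Real.log (Fintype.card 𝔽) := ht.trans (Real.log_le_log (by norm_num) hq)
    have hmain : ((Finset.univ.filter fun g : Fin n → A → 𝔽 => ¬ FullRank g rows cols).card : ℝ) *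
        (Fintype.card 𝔽 : ℝ) ^ rows.card ≤
        (Fintype.card 𝔽 : ℝ) ^ cols.card * Fintype.card (Fin n → A → 𝔽) := by
      exact_mod_cast card_not_fullRank_mul_le rows cols
    rw [← le_div_iff₀ (by positivity)] at hmain
    refine hmain.trans ?_
    rw [mul_div_right_comm]
    refine mul_le_mul_of_nonneg_right ?_ hG.le
    have hexp : ∀ m : ℕ, (Fintype.card 𝔽 : ℝ) ^ m = Real.exp (m * Real.log (Fintype.card 𝔽)) :=
      fun m => by rw [Real.exp_nat_mul, Real.exp_log hq0]
    rw [hexp, hexp, ← Real.exp_sub]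
    refine Real.exp_le_exp.2 ?_
    nlinarith
  · calc ((Finset.univ.filter fun g : Fin n → A → 𝔽 => ¬ FullRank g rows cols).card : ℝ)
        ≤ Fintype.card (Fin n → A → 𝔽) := by
          exact_mod_cast (Finset.card_filter_le _ _).trans_eq Finset.card_univ
      _ ≤ _ := by
          refine le_mul_of_one_le_left hG.le (Real.one_le_exp ?_)
          nlinarith

end RandomMatrix

/-! ### The error probability of a random coefficient table -/

section ErrorBound

variable {K n j : ℕ} {δ : ℝ}

open Classical in
/-- Contribution of a slot of sub-phase `I` with state `x` to the number of useful slots minus the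
number of unknown sources of user `k` in sub-phase `J`. -/
noncomputable def slackTerm (k : Fin K) (J I x : Finset (Fin K)) : ℝ :=
  (if I = J ∧ (k ∈ x ∨ ¬ x ⊆ J) then 1 else 0) - if Overheard I J x ∧ k ∉ x then 1 else 0

lemma abs_slackTerm_le (k : Fin K) (J I x : Finset (Fin K)) : |slackTerm k J I x| ≤ 1 := by
  unfold slackTerm
  split_ifs <;> norm_num

/-- The surplus of equations over unknowns for user `k` in sub-phase `J`, slot by slot. -/
lemma card_usefulSlots_sub {N : ℕ} {T : ℕ → ℕ} {sub : Fin n → Finset (Fin K)}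
    (hsub : IsSchedule j T sub) (s : Fin n → Finset (Fin K)) (k : Fin K) (J : Finset (Fin K)) :
    ((usefulSlots sub s k J).card : ℝ) - (unknownSources (orderLengths j N) j sub s k J).card =
      (∑ l, slackTerm k J (sub l) (s l)) - if J.card = j then (N : ℝ) else 0 := by
  classical
  have hrows : ((usefulSlots sub s k J).card : ℝ) =
      ∑ l, if sub l = J ∧ (k ∈ s l ∨ ¬ s l ⊆ J) then (1 : ℝ) else 0 := by
    rw [usefulSlots, Finset.card_filter, Nat.cast_sum]
    refine Finset.sum_congr rfl fun l _ => ?_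
    split_ifs <;> simp
  have hcols : ((unknownSources (orderLengths j N) j sub s k J).card : ℝ) =
      (if J.card = j then (N : ℝ) else 0) +
        ∑ l, if Overheard (sub l) J (s l) ∧ k ∉ s l then (1 : ℝ) else 0 := by
    rw [unknownSources, Finset.card_filter, Nat.cast_sum, Fintype.sum_sum_type]
    congr 1
    · rw [Fintype.sum_sigma, Finset.sum_eq_single J]
      · by_cases h : J.card = j
        · have hN : orderLengths j N J = N := if_pos h
          simp [IsAvailable, h, Finset.card_univ, hN]
        · simp [IsAvailable, h]
      · intro I _ hI
        simp [IsAvailable, hI]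
      · simp
    · refine Finset.sum_congr rfl fun l _ => ?_
      have : (IsAvailable (F := orderLengths j N) j sub s J (.inr l) ∧
          ∀ i, (Sum.inr l : Source (orderLengths (K := K) j N) n) = .inr i → k ∉ s i) ↔
          Overheard (sub l) J (s l) ∧ k ∉ s l := by
        constructor
        · exact fun h => ⟨h.1.2, h.2 l rfl⟩
        · refine fun h => ⟨⟨(hsub.le_card l).trans_lt (Finset.card_lt_card h.1.1), h.1⟩, ?_⟩
          intro i hi
          rw [← Sum.inr.inj hi]
          exact h.2
      rw [if_congr this rfl rfl]
      split_ifs <;> simp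
  rw [hrows, hcols]
  simp only [slackTerm, Finset.sum_sub_distrib]
  rw [sub_add_eq_sub_sub, sub_right_comm]

open Classical in
/-- Mean of `slackTerm`.  A slot is not useful if its packet misses `k` and everyone outside `J`.  A
packet of `I` is available to `J` and unknown to `k` if it reaches all of `J \ I` and misses `k` and
everyone outside `J`, which requires `k ∈ I`. -/
lemma sum_slotProb_slackTerm {k : Fin K} {J : Finset (Fin K)} (hk : k ∈ J) (I : Finset (Fin K)) :
    ∑ x, slotProb δ x * slackTerm k J I x =
      (if I = J then 1 - δ ^ (K - J.card + 1) else 0) -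
        if I ⊂ J ∧ k ∈ I then δ ^ (K - J.card + 1) * (1 - δ) ^ (J.card - I.card) else 0 := by
  have hB : (insert k Jᶜ).card = K - J.card + 1 := by
    rw [Finset.card_insert_of_notMem (by simpa using hk), Finset.card_compl, Fintype.card_fin]
  have hdisj : ∀ x : Finset (Fin K), Disjoint x (insert k Jᶜ) ↔ k ∉ x ∧ x ⊆ J := by
    intro x
    rw [Finset.disjoint_insert_right, disjoint_compl_right_iff]
  have h1 : ∑ x, slotProb δ x * (if I = J ∧ (k ∈ x ∨ ¬ x ⊆ J) then (1 : ℝ) else 0) =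
      if I = J then 1 - δ ^ (K - J.card + 1) else 0 := by
    by_cases h : I = J
    · have h2 := sum_slotProb_indicator (δ := δ) ∅ (insert k Jᶜ) (by simp)
      simp only [Finset.empty_subset, true_and, Finset.card_empty, pow_zero, one_mul, hB,
        hdisj] at h2
      rw [if_pos h, ← h2, eq_sub_iff_add_eq, ← Finset.sum_add_distrib]
      refine Eq.trans (Finset.sum_congr rfl fun x _ => ?_) (sum_slotProb (K := K) (δ := δ))
      by_cases hx : k ∉ x ∧ x ⊆ J
      · rw [if_neg (by tauto), if_pos hx]; ring
      · rw [if_pos ⟨h, by tauto⟩, if_neg hx]; ring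
    · simp [h]
  have h2 : ∑ x, slotProb δ x * (if Overheard I J x ∧ k ∉ x then (1 : ℝ) else 0) =
      if I ⊂ J ∧ k ∈ I then δ ^ (K - J.card + 1) * (1 - δ) ^ (J.card - I.card) else 0 := by
    by_cases h : I ⊂ J ∧ k ∈ I
    · have h3 := sum_slotProb_indicator (δ := δ) (J \ I) (insert k Jᶜ)
        ((hdisj _).2 ⟨fun hk' => (Finset.mem_sdiff.1 hk').2 h.2, Finset.sdiff_subset⟩)
      rw [hB, Finset.card_sdiff_of_subset h.1.subset] at h3
      rw [if_pos h, mul_comm (δ ^ _), ← h3]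
      refine Finset.sum_congr rfl fun x _ => ?_
      congr 1
      refine if_congr ?_ rfl rfl
      rw [hdisj]
      exact ⟨fun H => ⟨H.1.2.1, H.2, H.1.2.2.1⟩,
        fun H => ⟨⟨h.1, H.1, H.2.2, fun hI => H.2.1 (hI h.2)⟩, H.2.1⟩⟩
    · rw [if_neg h]
      refine Finset.sum_eq_zero fun x _ => ?_
      rw [if_neg, mul_zero]
      rintro ⟨H, hkx⟩
      exact h ⟨H.1, by_contra fun hkI => hkx (H.2.1 (Finset.mem_sdiff.2 ⟨hk, hkI⟩))⟩
  simp only [slackTerm, mul_sub, Finset.sum_sub_distrib]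
  rw [h1, h2]

/-- The subsets of `J` that contain `k`, grouped by cardinality. -/
lemma sum_ssubset_card {k : Fin K} {J : Finset (Fin K)} (hk : k ∈ J) (f : ℕ → ℝ) :
    ∑ I with I ⊂ J ∧ k ∈ I, f I.card =
      ∑ i ∈ Finset.range (J.card - 1), ((J.card - 1).choose i : ℝ) * f (i + 1) := by
  have h1 : ∑ I with I ⊂ J ∧ k ∈ I, f I.card =
      ∑ I' ∈ (J.erase k).powerset, if I'.card < J.card - 1 then f (I'.card + 1) else 0 := by
    rw [← Finset.sum_filter]
    have hJ : (J.erase k).card = J.card - 1 := Finset.card_erase_of_mem hk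
    refine Finset.sum_bij' (fun I _ => I.erase k) (fun I' _ => insert k I') ?_ ?_ ?_ ?_ ?_
    · intro I hI
      simp only [Finset.mem_filter, Finset.mem_univ, true_and, Finset.mem_powerset] at hI ⊢
      refine ⟨Finset.erase_subset_erase k hI.1.subset, ?_⟩
      have h2 := Finset.card_lt_card hI.1
      have h3 := Finset.card_erase_of_mem hI.2
      have h4 := Finset.card_pos.2 ⟨k, hI.2⟩
      omega
    · intro I' hI'
      simp only [Finset.mem_filter, Finset.mem_univ, true_and, Finset.mem_powerset] at hI' ⊢
      refine ⟨Finset.ssubset_iff_subset_ne.2 ⟨Finset.insert_subset hk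
        (hI'.1.trans (Finset.erase_subset _ _)), fun e => ?_⟩, Finset.mem_insert_self _ _⟩
      have h2 := congrArg Finset.card e
      rw [Finset.card_insert_of_notMem fun h => Finset.notMem_erase k J (hI'.1 h)] at h2
      omega
    · intro I hI
      exact Finset.insert_erase (Finset.mem_filter.1 hI).2.2
    · intro I' hI'
      simp only [Finset.mem_filter, Finset.mem_powerset] at hI'
      exact Finset.erase_insert fun h => Finset.notMem_erase k J (hI'.1 h)
    · intro I hI
      have h2 := (Finset.mem_filter.1 hI).2.2
      rw [Finset.card_erase_of_mem h2, Nat.sub_add_cancel (Finset.card_pos.2 ⟨k, h2⟩)]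
  rw [h1, Finset.sum_powerset_apply_card (fun i => if i < J.card - 1 then f (i + 1) else 0),
    Finset.card_erase_of_mem hk, Finset.sum_range_succ, if_neg (lt_irrefl _), smul_zero, add_zero]
  refine Finset.sum_congr rfl fun i hi => ?_
  rw [if_pos (Finset.mem_range.1 hi), nsmul_eq_mul]

/-- Expected number of useful slots minus expected number of unknown overheard packets. -/
lemma sum_mean_slackTerm {T : ℕ → ℕ} {sub : Fin n → Finset (Fin K)} (hsub : IsSchedule j T sub)
    (hT : ∀ m < j, T m = 0) {k : Fin K} {J : Finset (Fin K)} (hk : k ∈ J) :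
    ∑ l, ∑ x, slotProb δ x * slackTerm k J (sub l) x =
      T J.card * (1 - δ ^ (K - J.card + 1)) - δ ^ (K - J.card + 1) *
        ∑ i ∈ Finset.range (J.card - 1), ((J.card - 1).choose i : ℝ) *
          ((1 - δ) ^ (J.card - 1 - i) * T (i + 1)) := by
  classical
  have hcount : ∀ I : Finset (Fin K), ((Finset.univ.filter fun l => sub l = I).card : ℝ) =
      T I.card := by
    intro I
    rw [hsub.length]
    split_ifs with h
    · rfl
    · rw [hT _ (not_le.1 h)]
  simp_rw [sum_slotProb_slackTerm hk]
  rw [← Finset.sum_fiberwise (s := Finset.univ) (g := sub)]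
  have hfib : ∀ I : Finset (Fin K), ∑ l with sub l = I,
      ((if sub l = J then 1 - δ ^ (K - J.card + 1) else 0) -
        if sub l ⊂ J ∧ k ∈ sub l then δ ^ (K - J.card + 1) * (1 - δ) ^ (J.card - (sub l).card)
        else 0) = (if I = J then T I.card * (1 - δ ^ (K - J.card + 1)) else 0) -
        if I ⊂ J ∧ k ∈ I then
          δ ^ (K - J.card + 1) * ((1 - δ) ^ (J.card - I.card) * T I.card) else 0 := by
    intro I
    rw [Finset.sum_congr rfl fun l hl => by rw [(Finset.mem_filter.1 hl).2], Finset.sum_const,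
      nsmul_eq_mul, hcount]
    split_ifs <;> ring
  simp_rw [hfib, Finset.sum_sub_distrib]
  rw [Finset.sum_ite_eq' Finset.univ J, if_pos (Finset.mem_univ J), ← Finset.sum_filter,
    ← Finset.mul_sum, sum_ssubset_card hk fun i => (1 - δ) ^ (J.card - i) * (T i : ℝ)]
  congr 2
  refine Finset.sum_congr rfl fun i _ => ?_
  rw [Nat.sub_sub, add_comm 1 i]

/-- Chernoff bound for bounded functions of the independent states. -/
lemma sum_stateProb_exp_le (h0 : 0 ≤ δ) (h1 : δ ≤ 1) (f : Fin n → Finset (Fin K) → ℝ)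
    (hf : ∀ l x, |f l x| ≤ 1) {t : ℝ} (ht0 : 0 ≤ t) (ht1 : t ≤ 1) :
    ∑ s, stateProb δ s * Real.exp (-t * ∑ l, f l (s l)) ≤
      Real.exp (-t * (∑ l, ∑ x, slotProb δ x * f l x) + t ^ 2 * n) := by
  have hle : ∀ l, ∑ x, slotProb δ x * Real.exp (-t * f l x) ≤
      Real.exp (-t * (∑ x, slotProb δ x * f l x) + t ^ 2) := by
    intro l
    have hx : ∀ x, Real.exp (-t * f l x) ≤ 1 + -t * f l x + t ^ 2 := by
      intro x
      have habs : |-t * f l x| ≤ t := by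
        rw [abs_mul, abs_neg, abs_of_nonneg ht0]
        exact mul_le_of_le_one_right ht0 (hf l x)
      have h2 := Real.abs_exp_sub_one_sub_id_le (habs.trans ht1)
      have h3 := (abs_le.1 h2).2
      have h4 : (-t * f l x) ^ 2 ≤ t ^ 2 := sq_le_sq' (abs_le.1 habs).1 (abs_le.1 habs).2
      linarith
    calc ∑ x, slotProb δ x * Real.exp (-t * f l x)
        ≤ ∑ x, slotProb δ x * (1 + -t * f l x + t ^ 2) :=
          Finset.sum_le_sum fun x _ =>
            mul_le_mul_of_nonneg_left (hx x) (slotProb_nonneg h0 h1 x)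
      _ = -t * (∑ x, slotProb δ x * f l x) + t ^ 2 + 1 := by
          have : ∀ x, slotProb δ x * (1 + -t * f l x + t ^ 2) =
              slotProb δ x * (1 + t ^ 2) + -t * (slotProb δ x * f l x) := fun x => by ring
          simp_rw [this, Finset.sum_add_distrib, ← Finset.sum_mul, ← Finset.mul_sum, sum_slotProb]
          ring
      _ ≤ _ := Real.add_one_le_exp _
  calc ∑ s, stateProb δ s * Real.exp (-t * ∑ l, f l (s l))
      = ∏ l, ∑ x, slotProb δ x * Real.exp (-t * f l x) := by
        rw [← sum_stateProb_mul_prod]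
        refine Finset.sum_congr rfl fun s _ => ?_
        rw [Finset.mul_sum, Real.exp_sum]
    _ ≤ ∏ l, Real.exp (-t * (∑ x, slotProb δ x * f l x) + t ^ 2) :=
        Finset.prod_le_prod (fun l _ => Finset.sum_nonneg fun x _ =>
          mul_nonneg (slotProb_nonneg h0 h1 x) (Real.exp_pos _).le) fun l _ => hle l
    _ = _ := by
        rw [← Real.exp_sum, Finset.sum_add_distrib, ← Finset.mul_sum]
        simp [mul_comm]

lemma errorProb_nonneg {𝔽 : Type*} [Fintype 𝔽] {F : Finset (Fin K) → ℕ} (h0 : 0 ≤ δ) (h1 : δ ≤ 1)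
    (c : Code 𝔽 K n F) (k : Fin K) : 0 ≤ c.errorProb δ k :=
  Finset.sum_nonneg fun s _ => mul_nonneg (stateProb_nonneg h0 h1 s) (by positivity)

variable {𝔽 : Type*} [Field 𝔽] [Fintype 𝔽]

open Classical in
/-- Union bound over the sub-phases that concern user `k`. -/
lemma errorProb_schemeCode_le {N : ℕ} {T : ℕ → ℕ} {sub : Fin n → Finset (Fin K)}
    (hsub : IsSchedule j T sub) (h0 : 0 ≤ δ) (h1 : δ ≤ 1)
    (g : Fin n → Source (orderLengths (K := K) j N) n → 𝔽) (k : Fin K) :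
    (schemeCode j sub g).errorProb δ k ≤ ∑ J with k ∈ J ∧ j ≤ J.card, ∑ s, stateProb δ s *
      if ¬ FullRank g (usefulSlots sub s k J) (unknownSources (orderLengths j N) j sub s k J)
        then 1 else 0 := by
  rw [Finset.sum_comm, Code.errorProb]
  refine Finset.sum_le_sum fun s _ => ?_
  rw [← Finset.mul_sum]
  refine mul_le_mul_of_nonneg_left ?_ (stateProb_nonneg h0 h1 s)
  by_cases hall : ∀ J, k ∈ J → j ≤ J.card → FullRank g (usefulSlots sub s k J)
      (unknownSources (orderLengths j N) j sub s k J)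
  · rw [Finset.filter_false_of_mem fun w _ => not_err_schemeCode hsub g s k hall w]
    simp only [Finset.card_empty, Nat.cast_zero, zero_div]
    exact Finset.sum_nonneg fun J _ => by split_ifs <;> norm_num
  · push Not at hall
    obtain ⟨J, hkJ, hJ, hbad⟩ := hall
    have hle : ((Finset.univ.filter fun w => (schemeCode j sub g).Err k w s).card : ℝ) /
        (Fintype.card (Message 𝔽 (orderLengths (K := K) j N)) : ℝ) ≤ 1 := by
      refine div_le_one_of_le₀ ?_ (Nat.cast_nonneg _)
      exact_mod_cast (Finset.card_filter_le _ _).trans_eq Finset.card_univ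
    refine hle.trans ?_
    refine le_trans (le_of_eq ?_) (Finset.single_le_sum (f := fun J : Finset (Fin K) =>
      if ¬ FullRank g (usefulSlots sub s k J) (unknownSources (orderLengths j N) j sub s k J)
        then (1 : ℝ) else 0) (fun J _ => by split_ifs <;> norm_num)
      (Finset.mem_filter.2 ⟨Finset.mem_univ J, hkJ, hJ⟩))
    rw [if_pos hbad]

/-- If in every sub-phase every user expects at least `a` useful slots more than it has unknown
sources, some coefficient table has an exponentially small error probability. -/
lemma exists_table_errorProb_le {N : ℕ} {T : ℕ → ℕ} {sub : Fin n → Finset (Fin K)}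
    (hsub : IsSchedule j T sub) (h0 : 0 ≤ δ) (h1 : δ ≤ 1) {t a : ℝ} (ht0 : 0 ≤ t)
    (ht : t ≤ Real.log 2)
    (ha : ∀ (k : Fin K) (J : Finset (Fin K)), k ∈ J → j ≤ J.card →
      a ≤ (∑ l, ∑ x, slotProb δ x * slackTerm k J (sub l) x) - if J.card = j then (N : ℝ) else 0) :
    ∃ g : Fin n → Source (orderLengths (K := K) j N) n → 𝔽, ∀ k,
      (schemeCode j sub g).errorProb δ k ≤ K * 2 ^ K * Real.exp (-t * a + t ^ 2 * n) := by
  classical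
  set B := Real.exp (-t * a + t ^ 2 * n) with hB
  have ht1 : t ≤ 1 := ht.trans (by linarith [Real.log_two_lt_d9])
  have hexp : ∀ P S b C : ℝ, P * (Real.exp (-t * (S - b)) * C) =
      P * Real.exp (-t * S) * Real.exp (t * b) * C := by
    intro P S b C
    rw [show -t * (S - b) = -t * S + t * b by ring, Real.exp_add]
    ring
  have hbad : ∀ (k : Fin K) (J : Finset (Fin K)), k ∈ J → j ≤ J.card →
      ∑ g : Fin n → Source (orderLengths (K := K) j N) n → 𝔽, ∑ s, stateProb δ s *
        (if ¬ FullRank g (usefulSlots sub s k J) (unknownSources (orderLengths j N) j sub s k J)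
          then (1 : ℝ) else 0) ≤
        B * Fintype.card (Fin n → Source (orderLengths (K := K) j N) n → 𝔽) := by
    intro k J hkJ hJ
    rw [Finset.sum_comm]
    calc ∑ s, ∑ g : Fin n → Source (orderLengths (K := K) j N) n → 𝔽, stateProb δ s *
          (if ¬ FullRank g (usefulSlots sub s k J) (unknownSources (orderLengths j N) j sub s k J)
            then (1 : ℝ) else 0)
        ≤ ∑ s, stateProb δ s * (Real.exp (-t * ((∑ l, slackTerm k J (sub l) (s l)) -
            if J.card = j then (N : ℝ) else 0)) *
              Fintype.card (Fin n → Source (orderLengths (K := K) j N) n → 𝔽)) := by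
          refine Finset.sum_le_sum fun s _ => ?_
          rw [← Finset.mul_sum]
          refine mul_le_mul_of_nonneg_left ?_ (stateProb_nonneg h0 h1 s)
          rw [Finset.sum_boole, ← card_usefulSlots_sub hsub]
          exact card_not_fullRank_le_exp _ _ ht0 ht
      _ = (∑ s, stateProb δ s * Real.exp (-t * ∑ l, slackTerm k J (sub l) (s l))) *
            Real.exp (t * if J.card = j then (N : ℝ) else 0) *
              Fintype.card (Fin n → Source (orderLengths (K := K) j N) n → 𝔽) := by
          rw [Finset.sum_mul, Finset.sum_mul]
          exact Finset.sum_congr rfl fun s _ => hexp _ _ _ _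
      _ ≤ _ := by
          refine mul_le_mul_of_nonneg_right ?_ (Nat.cast_nonneg _)
          refine (mul_le_mul_of_nonneg_right (sum_stateProb_exp_le h0 h1
            (fun l => slackTerm k J (sub l)) (fun l x => abs_slackTerm_le k J (sub l) x) ht0 ht1)
            (Real.exp_pos _).le).trans ?_
          rw [← Real.exp_add, hB]
          refine Real.exp_le_exp.2 ?_
          have := mul_le_mul_of_nonneg_left (ha k J hkJ hJ) ht0
          rw [mul_sub] at this
          linarith
  have htotal : ∑ g : Fin n → Source (orderLengths (K := K) j N) n → 𝔽,
      ∑ k, (schemeCode j sub g).errorProb δ k ≤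
      ∑ _g : Fin n → Source (orderLengths (K := K) j N) n → 𝔽, K * 2 ^ K * B := by
    rw [Finset.sum_comm, Finset.sum_const, nsmul_eq_mul, Finset.card_univ]
    have hk : ∀ k, ∑ g : Fin n → Source (orderLengths (K := K) j N) n → 𝔽,
        (schemeCode j sub g).errorProb δ k ≤
        2 ^ K * (B * Fintype.card (Fin n → Source (orderLengths (K := K) j N) n → 𝔽)) := by
      intro k
      refine (Finset.sum_le_sum fun g _ => errorProb_schemeCode_le hsub h0 h1 g k).trans ?_
      rw [Finset.sum_comm]
      refine (Finset.sum_le_sum fun J hJ => hbad k J (Finset.mem_filter.1 hJ).2.1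
        (Finset.mem_filter.1 hJ).2.2).trans ?_
      rw [Finset.sum_const, nsmul_eq_mul]
      refine mul_le_mul_of_nonneg_right ?_ (mul_nonneg (Real.exp_pos _).le (Nat.cast_nonneg _))
      have : (Finset.univ.filter fun J : Finset (Fin K) => k ∈ J ∧ j ≤ J.card).card ≤ 2 ^ K :=
        (Finset.card_filter_le _ _).trans_eq (by simp)
      exact_mod_cast this
    refine (Finset.sum_le_sum fun k _ => hk k).trans (le_of_eq ?_)
    simp only [Finset.sum_const, Finset.card_univ, Fintype.card_fin, nsmul_eq_mul]
    ring
  obtain ⟨g, -, hg⟩ := Finset.exists_le_of_sum_le Finset.univ_nonempty htotal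
  exact ⟨g, fun k => (Finset.single_le_sum (fun k _ => errorProb_nonneg h0 h1 _ k)
    (Finset.mem_univ k)).trans hg⟩

end ErrorBound

/-! ### Choice of the sub-phase lengths, and the capacity -/

section Parameters

variable {K j : ℕ} {δ : ℝ}

/-- The margin added to the sub-phase lengths grows geometrically with the phase, so that the margin
of each phase outweighs the additional packets caused by the margins of the earlier phases. -/
noncomputable def marginBase (K : ℕ) (δ : ℝ) : ℝ := (2 ^ K + 1) / (1 - δ)

/-- Sub-phase lengths of the algorithm for `N` packets per message, with margin `η`. -/
noncomputable def phaseLength (K j : ℕ) (δ η : ℝ) (N m : ℕ) : ℕ :=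
  if j ≤ m then ⌈(subphaseLength K j δ m + η * marginBase K δ ^ m) * N⌉₊ else 0

lemma one_le_marginBase (h0 : 0 ≤ δ) (h1 : δ < 1) : 1 ≤ marginBase K δ := by
  rw [marginBase, one_le_div (by linarith)]
  have : (0 : ℝ) ≤ 2 ^ K := by positivity
  linarith

lemma phaseLength_le (h0 : 0 ≤ δ) (h1 : δ < 1) {η : ℝ} (hη : 0 ≤ η) (N m : ℕ) :
    (phaseLength K j δ η N m : ℝ) ≤
      (subphaseLength K j δ m + η * marginBase K δ ^ m) * N + 1 := by
  have hpos : 0 ≤ (subphaseLength K j δ m + η * marginBase K δ ^ m) * N := by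
    have h2 := subphaseLength_nonneg (K := K) (j := j) h0 h1.le m
    have h3 := one_le_marginBase (K := K) h0 h1
    positivity
  rw [phaseLength]
  split_ifs
  · exact (Nat.ceil_lt_add_one hpos).le
  · rw [Nat.cast_zero]; linarith

lemma le_phaseLength {η : ℝ} (N : ℕ) {m : ℕ} (hm : j ≤ m) :
    (subphaseLength K j δ m + η * marginBase K δ ^ m) * N ≤ phaseLength K j δ η N m := by
  rw [phaseLength, if_pos hm]
  exact Nat.le_ceil _

/-- With the margin `η`, the expected surplus of useful slots over unknown packets in a sub-phase of
phase `p + 1` is at least `η * N`, up to the rounding of the lengths. -/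
lemma margin_le_mean (hj : 1 ≤ j) (h0 : 0 ≤ δ) (h1 : δ < 1) {η : ℝ} (hη : 0 ≤ η) (N : ℕ) {p : ℕ}
    (hp : p < K) (hjp : j ≤ p + 1) :
    η * N - 2 ^ K ≤ phaseLength K j δ η N (p + 1) * (1 - δ ^ (K - p)) - δ ^ (K - p) *
      ∑ i ∈ Finset.range p, (p.choose i : ℝ) *
        ((1 - δ) ^ (p - i) * phaseLength K j δ η N (i + 1)) - if p + 1 = j then (N : ℝ) else 0 := by
  set M := marginBase K δ with hM
  set d := δ ^ (K - p) with hd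
  have hM1 : 1 ≤ M := one_le_marginBase h0 h1
  have hd0 : 0 ≤ d := pow_nonneg h0 _
  have hdδ : d ≤ δ := by
    refine (pow_le_pow_of_le_one h0 h1.le (by omega : 1 ≤ K - p)).trans_eq (pow_one δ)
  have hd1 : 0 < 1 - d := by linarith
  have hMδ : M * (1 - δ) = 2 ^ K + 1 := div_mul_cancel₀ _ (by linarith)
  have hMp : 1 ≤ M ^ p := one_le_pow₀ hM1
  have h2pK : (2 : ℝ) ^ p ≤ 2 ^ K := pow_le_pow_right₀ (by norm_num) hp.le
  have hchoose : ∑ i ∈ Finset.range p, (p.choose i : ℝ) ≤ 2 ^ K := by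
    refine le_trans ?_ h2pK
    have : ∑ i ∈ Finset.range p, p.choose i ≤ 2 ^ p := by
      rw [← Nat.sum_range_choose, Finset.sum_range_succ]
      omega
    exact_mod_cast this
  have hrec := subphaseLength_succ (δ := δ) hj h0 h1 hp
  rw [Finset.sum_range_succ] at hrec
  simp only [Nat.choose_self, Nat.sub_self, pow_zero, Nat.cast_one, one_mul] at hrec
  set X := ∑ i ∈ Finset.range p, (p.choose i : ℝ) * (1 - δ) ^ (p - i) *
    subphaseLength K j δ (i + 1) with hX
  have hsum : ∑ i ∈ Finset.range p, (p.choose i : ℝ) *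
      ((1 - δ) ^ (p - i) * phaseLength K j δ η N (i + 1)) ≤
      X * N + 2 ^ K * (η * M ^ p * N + 1) := by
    calc ∑ i ∈ Finset.range p, (p.choose i : ℝ) *
          ((1 - δ) ^ (p - i) * phaseLength K j δ η N (i + 1))
        ≤ ∑ i ∈ Finset.range p, ((p.choose i : ℝ) * (1 - δ) ^ (p - i) *
            subphaseLength K j δ (i + 1) * N + p.choose i * (η * M ^ p * N + 1)) := by
          refine Finset.sum_le_sum fun i hi => ?_
          have hw0 : 0 ≤ (1 - δ) ^ (p - i) := pow_nonneg (by linarith) _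
          have hw1 : (1 - δ) ^ (p - i) ≤ 1 := pow_le_one₀ (by linarith) (by linarith)
          have hle := phaseLength_le (K := K) (j := j) h0 h1 hη N (i + 1)
          have hpow : M ^ (i + 1) ≤ M ^ p := pow_le_pow_right₀ hM1 (Finset.mem_range.1 hi)
          have hNη : 0 ≤ η * N := by positivity
          have h3 : (phaseLength K j δ η N (i + 1) : ℝ) ≤
              subphaseLength K j δ (i + 1) * N + (η * M ^ p * N + 1) := by
            have := mul_le_mul_of_nonneg_left hpow hNη
            rw [← hM] at hle
            linarith
          have h4 : (1 - δ) ^ (p - i) * phaseLength K j δ η N (i + 1) ≤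
              (1 - δ) ^ (p - i) * (subphaseLength K j δ (i + 1) * N) + (η * M ^ p * N + 1) := by
            refine (mul_le_mul_of_nonneg_left h3 hw0).trans ?_
            rw [mul_add]
            have : 0 ≤ η * M ^ p * N + 1 := by positivity
            have := mul_le_of_le_one_left this hw1
            linarith
          have := mul_le_mul_of_nonneg_left h4 (Nat.cast_nonneg (α := ℝ) (p.choose i))
          linarith
      _ = X * N + (∑ i ∈ Finset.range p, (p.choose i : ℝ)) * (η * M ^ p * N + 1) := by
          rw [Finset.sum_add_distrib, ← Finset.sum_mul, ← Finset.sum_mul]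
      _ ≤ _ := by
          have := mul_le_mul_of_nonneg_right hchoose
            (by positivity : 0 ≤ η * M ^ p * N + 1)
          linarith
  have hge := le_phaseLength (K := K) (δ := δ) (η := η) N hjp
  rw [← hM] at hge
  have h5 := mul_le_mul_of_nonneg_right hge hd1.le
  have h6 := mul_le_mul_of_nonneg_left hsum hd0
  have h7 : subphaseLength K j δ (p + 1) * (1 - d) * N =
      (if p + 1 = j then (N : ℝ) else 0) + d * X * N := by
    have : subphaseLength K j δ (p + 1) * (1 - d) = (if p + 1 = j then 1 else 0) + d * X := by
      linear_combination hrec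
    rw [this]
    split_ifs <;> ring
  have hηN : 0 ≤ η * N := by positivity
  -- The margin of this phase exceeds the margins of the earlier phases by at least one unit.
  have h8 : 1 ≤ M ^ (p + 1) * (1 - d) - d * (2 ^ K * M ^ p) := by
    have e1 : M ^ (p + 1) * (1 - δ) = (2 ^ K + 1) * M ^ p := by
      rw [pow_succ]; linear_combination M ^ p * hMδ
    have e2 : M ^ (p + 1) * (1 - δ) ≤ M ^ (p + 1) * (1 - d) :=
      mul_le_mul_of_nonneg_left (by linarith) (by positivity)
    have e3 : d * (2 ^ K * M ^ p) ≤ 2 ^ K * M ^ p :=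
      mul_le_of_le_one_left (by positivity) (by linarith)
    linarith
  have h9 := mul_le_mul_of_nonneg_left h8 hηN
  have h10 : d * 2 ^ K ≤ 2 ^ K := mul_le_of_le_one_left (by positivity) (by linarith)
  linarith

lemma sum_card_eq (f : ℕ → ℝ) :
    ∑ J : Finset (Fin K), f J.card = ∑ m ∈ Finset.range (K + 1), (K.choose m : ℝ) * f m := by
  rw [← Finset.powerset_univ, Finset.sum_powerset_apply_card, Finset.card_univ, Fintype.card_fin]
  simp [nsmul_eq_mul]

/-- The multi-phase algorithm achieves `orderBound`. -/
theorem exists_multiphase (𝔽 : Type*) [Field 𝔽] [Fintype 𝔽] (hj : 1 ≤ j) (hjK : j ≤ K)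
    (h0 : 0 ≤ δ) (h1 : δ < 1) {ε : ℝ} (hε : 0 < ε) :
    ∃ N₀ : ℕ, ∀ N : ℕ, N₀ ≤ N →
      ∃ (n : ℕ) (T : ℕ → ℕ) (c : Code 𝔽 K n (orderLengths j N)),
        0 < n ∧ IsMultiphase c j T ∧
        (∀ m, j ≤ m → m ≤ K → |(T m : ℝ) - subphaseLength K j δ m * N| ≤ ε * N) ∧
        (∀ k, c.errorProb δ k < ε) ∧
        |(K.choose j : ℝ) * N / n - orderBound K j δ| < ε := by
  set M := marginBase K δ with hM
  have hM1 : 1 ≤ M := one_le_marginBase h0 h1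
  have hMpos : 0 < M := by linarith
  set S := ∑ m ∈ Finset.range (K + 1), (K.choose m : ℝ) * subphaseLength K j δ m with hS
  have hSB : orderBound K j δ = K.choose j / S := by
    rw [orderBound, hS, sum_choose_mul_subphaseLength_eq hj hjK h0 h1]
  have hSpos : 0 < S := by
    rw [hS, sum_choose_mul_subphaseLength_eq hj hjK h0 h1]
    exact orderBound_denom_pos hjK h0 h1
  set V := ∑ m ∈ Finset.range (K + 1), (K.choose m : ℝ) * M ^ m with hV
  have hVpos : 0 < V := by
    refine Finset.sum_pos (fun m hm => ?_) ⟨0, by simp⟩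
    have : 0 < K.choose m := Nat.choose_pos (Nat.lt_succ_iff.1 (Finset.mem_range.1 hm))
    positivity
  obtain ⟨θ, hθ, hcont⟩ := Metric.continuousAt_iff.1
    (show ContinuousAt (fun x : ℝ => (K.choose j : ℝ) / x) S from
      continuousAt_const.div continuousAt_id hSpos.ne') ε hε
  -- The margin keeps the lengths within `ε N / 2` and the total length per packet within `θ / 2`.
  set η := min (ε / (2 * M ^ K)) (θ / (2 * V)) with hη
  have hηpos : 0 < η := lt_min (by positivity) (by positivity)
  have hηM : η * M ^ K ≤ ε / 2 := by
    have := mul_le_mul_of_nonneg_right (min_le_left (ε / (2 * M ^ K)) (θ / (2 * V)))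
      (by positivity : 0 ≤ M ^ K)
    refine this.trans (le_of_eq ?_)
    field_simp
  have hηV : η * V ≤ θ / 2 := by
    have := mul_le_mul_of_nonneg_right (min_le_right (ε / (2 * M ^ K)) (θ / (2 * V))) hVpos.le
    refine this.trans (le_of_eq ?_)
    field_simp
  -- `n ≤ C * N`; the Chernoff parameter `t` makes the quadratic term at most half the linear one.
  set C := S + η * V + 2 ^ K with hC
  have hCpos : 0 < C := by positivity
  set t := min (Real.log 2) (η / (2 * C)) with ht
  have htpos : 0 < t := lt_min (Real.log_pos (by norm_num)) (by positivity)
  have htC : t * C ≤ η / 2 := by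
    have := mul_le_mul_of_nonneg_right (min_le_right (Real.log 2) (η / (2 * C))) hCpos.le
    refine this.trans (le_of_eq ?_)
    field_simp
  have hlim : Filter.Tendsto (fun N : ℕ => (K : ℝ) * 2 ^ K *
      Real.exp (t * 2 ^ K + -(t * η / 2) * N)) Filter.atTop (nhds 0) := by
    have hlin : Filter.Tendsto (fun N : ℕ => t * 2 ^ K + -(t * η / 2) * (N : ℝ))
        Filter.atTop Filter.atBot :=
      Filter.tendsto_atBot_add_const_left _ _
        (tendsto_natCast_atTop_atTop.const_mul_atTop_of_neg (by
          have := mul_pos htpos hηpos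
          linarith))
    simpa using (Real.tendsto_exp_atBot.comp hlin).const_mul ((K : ℝ) * 2 ^ K)
  obtain ⟨N₁, hN₁⟩ := Filter.eventually_atTop.1 (hlim.eventually (gt_mem_nhds hε))
  obtain ⟨N₂, hN₂⟩ := exists_nat_gt (2 / ε)
  obtain ⟨N₃, hN₃⟩ := exists_nat_gt (2 ^ K / (θ / 2))
  refine ⟨max (max N₁ N₂) (max N₃ 1), fun N hN => ?_⟩
  have hNN₁ : N₁ ≤ N := (le_max_left _ _).trans ((le_max_left _ _).trans hN)
  have hNN₂ : N₂ ≤ N := (le_max_right _ _).trans ((le_max_left _ _).trans hN)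
  have hNN₃ : N₃ ≤ N := (le_max_left _ _).trans ((le_max_right _ _).trans hN)
  have hN1 : 1 ≤ N := (le_max_right _ _).trans ((le_max_right _ _).trans hN)
  have hN1' : (1 : ℝ) ≤ N := by exact_mod_cast hN1
  have hNpos : (0 : ℝ) < N := by linarith
  have hNε : 1 ≤ ε / 2 * N := by
    have h2 : (2 / ε : ℝ) ≤ N := hN₂.le.trans (by exact_mod_cast hNN₂)
    rw [div_le_iff₀ hε] at h2
    linarith
  have hNθ : 2 ^ K < θ / 2 * N := by
    have h2 : (2 ^ K / (θ / 2) : ℝ) < N := hN₃.trans_le (by exact_mod_cast hNN₃)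
    rw [div_lt_iff₀ (by positivity)] at h2
    linarith
  let T : ℕ → ℕ := phaseLength K j δ η N
  obtain ⟨n, hn⟩ : ∃ n, n = ∑ J : Finset (Fin K), if j ≤ J.card then T J.card else 0 := ⟨_, rfl⟩
  obtain ⟨sub, hsub⟩ := exists_isSchedule j T hn
  have hT0 : ∀ m < j, T m = 0 := fun m hm => if_neg (not_le.2 hm)
  have hnT : (n : ℝ) = ∑ m ∈ Finset.range (K + 1), (K.choose m : ℝ) * T m := by
    rw [hn, Nat.cast_sum, ← sum_card_eq fun m => (T m : ℝ)]
    refine Finset.sum_congr rfl fun J _ => ?_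
    split_ifs with h
    · rfl
    · rw [hT0 _ (not_le.1 h)]
  have hn_ge : S * N ≤ n := by
    rw [hnT, hS, Finset.sum_mul]
    refine Finset.sum_le_sum fun m _ => ?_
    rw [mul_assoc]
    refine mul_le_mul_of_nonneg_left ?_ (Nat.cast_nonneg _)
    by_cases hm : j ≤ m
    · refine le_trans ?_ (le_phaseLength N hm)
      exact mul_le_mul_of_nonneg_right (le_add_of_nonneg_right (by positivity)) hNpos.le
    · rw [subphaseLength_of_lt (not_le.1 hm), zero_mul]
      exact Nat.cast_nonneg _
  have hn_le : n ≤ (S + η * V) * N + 2 ^ K := by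
    have h2 : (2 : ℝ) ^ K = ∑ m ∈ Finset.range (K + 1), (K.choose m : ℝ) := by
      exact_mod_cast (Nat.sum_range_choose K).symm
    rw [hnT, hS, hV, h2, Finset.mul_sum, ← Finset.sum_add_distrib, Finset.sum_mul,
      ← Finset.sum_add_distrib]
    refine Finset.sum_le_sum fun m _ => ?_
    have := mul_le_mul_of_nonneg_left (phaseLength_le (K := K) (j := j) h0 h1 hηpos.le N m)
      (Nat.cast_nonneg (α := ℝ) (K.choose m))
    rw [← hM] at this
    simp only [T]
    linarith
  have hnpos : (0 : ℝ) < n := lt_of_lt_of_le (by positivity) hn_ge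
  have hn_C : n ≤ C * N := by
    have : (2 : ℝ) ^ K ≤ 2 ^ K * N := le_mul_of_one_le_right (by positivity) hN1'
    rw [hC, add_mul]
    linarith
  obtain ⟨g, hg⟩ := exists_table_errorProb_le (𝔽 := 𝔽) (N := N) (a := η * N - 2 ^ K) hsub h0 h1.le
    htpos.le (min_le_left _ _) (by
      intro k J hk hJ
      obtain ⟨p, hp⟩ : ∃ p, J.card = p + 1 :=
        Nat.exists_eq_succ_of_ne_zero (Finset.card_pos.2 ⟨k, hk⟩).ne'
      have hJK : J.card ≤ K := by simpa using Finset.card_le_univ J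
      have hpK : K - (p + 1) + 1 = K - p := by omega
      rw [sum_mean_slackTerm hsub hT0 hk, hp, hpK, Nat.add_sub_cancel]
      exact margin_le_mean hj h0 h1 hηpos.le N (by omega) (by omega))
  refine ⟨n, T, schemeCode j sub g, by exact_mod_cast hnpos, isMultiphase_schemeCode hsub g,
    fun m hjm hmK => ?_, fun k => ?_, ?_⟩
  · have h2 := le_phaseLength (K := K) (δ := δ) (η := η) N hjm
    have h3 := phaseLength_le (K := K) (j := j) h0 h1 hηpos.le N m
    have h4 : η * M ^ m ≤ ε / 2 :=
      (mul_le_mul_of_nonneg_left (pow_le_pow_right₀ hM1 hmK) hηpos.le).trans hηM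
    have h5 := mul_le_mul_of_nonneg_right h4 hNpos.le
    have h6 : 0 ≤ η * M ^ m * N := by positivity
    rw [← hM] at h2 h3
    rw [abs_le]
    constructor
    · linarith
    · linarith
  · refine (hg k).trans_lt (lt_of_le_of_lt ?_ (hN₁ N hNN₁))
    refine mul_le_mul_of_nonneg_left (Real.exp_le_exp.2 ?_) (by positivity)
    have h2 : t ^ 2 * n ≤ t * (η / 2 * N) := by
      calc t ^ 2 * n ≤ t ^ 2 * (C * N) := mul_le_mul_of_nonneg_left hn_C (by positivity)
        _ = t * (t * C * N) := by ring
        _ ≤ _ := mul_le_mul_of_nonneg_left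
          (mul_le_mul_of_nonneg_right htC hNpos.le) htpos.le
    linarith
  · have hdist : dist ((n : ℝ) / N) S < θ := by
      rw [Real.dist_eq, abs_lt]
      constructor
      · have : S ≤ n / N := (le_div_iff₀ hNpos).2 hn_ge
        linarith
      · rw [sub_lt_iff_lt_add, div_lt_iff₀ hNpos]
        have := mul_le_mul_of_nonneg_right hηV hNpos.le
        linarith
    have h2 := hcont hdist
    rw [Real.dist_eq, ← hSB, div_div_eq_mul_div] at h2
    exact h2

/-- Every equal-rate tuple below the bound is achieved by the multi-phase algorithm. -/
lemma achievable_of_lt (𝔽 : Type*) [Field 𝔽] [Fintype 𝔽] (hj : 1 ≤ j) (hjK : j ≤ K)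
    (h0 : 0 ≤ δ) (h1 : δ < 1) {ρ : ℝ} (hρ0 : 0 ≤ ρ) (hρ : K.choose j * ρ < orderBound K j δ) :
    Achievable 𝔽 K j δ fun _ => ρ := by
  refine ⟨fun _ _ => hρ0, fun ε hε => ?_⟩
  obtain ⟨N₀, h⟩ := exists_multiphase 𝔽 hj hjK h0 h1 (lt_min hε (sub_pos.2 hρ))
  obtain ⟨n, T, c, hn, -, -, herr, hrate⟩ := h N₀ le_rfl
  refine ⟨n, _, c, hn, fun k => (herr k).trans_le (min_le_left _ _), fun J hJ => ?_⟩
  have hC : (0 : ℝ) < K.choose j := by exact_mod_cast Nat.choose_pos hjK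
  have h2 := (abs_lt.1 (hrate.trans_le (min_le_right _ _))).1
  rw [orderLengths, if_pos hJ]
  refine lt_of_mul_lt_mul_left ?_ hC.le
  rw [← mul_div_assoc]
  linarith

lemma sumRate_const (ρ : ℝ) : sumRate K j (fun _ => ρ) = K.choose j * ρ := by
  simp [sumRate]

lemma symmetricSumRates_subset (𝔽 : Type*) [Fintype 𝔽] :
    symmetricSumRates 𝔽 K j δ ⊆ sumRates 𝔽 K j δ := by
  rintro r ⟨ρ, hρ, rfl⟩
  exact ⟨fun _ => ρ, hρ, (sumRate_const ρ).symm⟩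

lemma orderBound_pos (hjK : j ≤ K) (h0 : 0 ≤ δ) (h1 : δ < 1) : 0 < orderBound K j δ :=
  div_pos (by exact_mod_cast Nat.choose_pos hjK) (orderBound_denom_pos hjK h0 h1)

lemma orderBound_le_of_mem_upperBounds (𝔽 : Type*) [Field 𝔽] [Fintype 𝔽] (hj : 1 ≤ j)
    (hjK : j ≤ K) (h0 : 0 ≤ δ) (h1 : δ < 1) {b : ℝ}
    (hb : b ∈ upperBounds (symmetricSumRates 𝔽 K j δ)) : orderBound K j δ ≤ b := by
  have hC : (0 : ℝ) < K.choose j := by exact_mod_cast Nat.choose_pos hjK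
  refine le_of_forall_lt fun r hr => ?_
  obtain ⟨r', hr', hr'B⟩ := exists_between (max_lt hr (orderBound_pos hjK h0 h1))
  have hr0 : 0 < r' := (le_max_right _ _).trans_lt hr'
  have hmul : K.choose j * (r' / K.choose j) = r' := mul_div_cancel₀ _ hC.ne'
  have := hb ⟨r' / K.choose j, achievable_of_lt 𝔽 hj hjK h0 h1 (by positivity)
    (by rwa [hmul]), rfl⟩
  rw [hmul] at this
  exact ((le_max_left _ _).trans_lt hr').trans_le this

end Parameters

end ErasureBC

theorem theorem3 (𝔽 : Type*) [Field 𝔽] [Fintype 𝔽] (K j : ℕ) (hj : 1 ≤ j) (hjK : j ≤ K)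
    (δ : ℝ) (hδ0 : 0 ≤ δ) (hδ1 : δ < 1) :
    (∀ R : Finset (Fin K) → ℝ, ErasureBC.Achievable 𝔽 K j δ R →
      ErasureBC.sumRate K j R ≤ ErasureBC.orderBound K j δ) ∧
    IsLUB (ErasureBC.sumRates 𝔽 K j δ) (ErasureBC.orderBound K j δ) ∧
    IsLUB (ErasureBC.symmetricSumRates 𝔽 K j δ) (ErasureBC.orderBound K j δ) ∧
    ∀ ε : ℝ, 0 < ε → ∃ N₀ : ℕ, ∀ N : ℕ, N₀ ≤ N →
      ∃ (n : ℕ) (T : ℕ → ℕ) (c : ErasureBC.Code 𝔽 K n (ErasureBC.orderLengths j N)),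
        0 < n ∧
        ErasureBC.IsMultiphase c j T ∧
        (∀ m, j ≤ m → m ≤ K →
          |(T m : ℝ) - ErasureBC.subphaseLength K j δ m * N| ≤ ε * N) ∧
        (∀ k, c.errorProb δ k < ε) ∧
        |(K.choose j : ℝ) * N / n - ErasureBC.orderBound K j δ| < ε := by
  have hupper : ErasureBC.orderBound K j δ ∈ upperBounds (ErasureBC.sumRates 𝔽 K j δ) := by
    rintro r ⟨R, hR, rfl⟩
    exact ErasureBC.sumRate_le_orderBound hj hjK hδ0 hδ1 hR
  have hsub := ErasureBC.symmetricSumRates_subset (K := K) (j := j) (δ := δ) 𝔽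
  have hlower : ∀ b ∈ upperBounds (ErasureBC.symmetricSumRates 𝔽 K j δ),
      ErasureBC.orderBound K j δ ≤ b := fun b hb =>
    ErasureBC.orderBound_le_of_mem_upperBounds 𝔽 hj hjK hδ0 hδ1 hb
  exact ⟨fun R hR => ErasureBC.sumRate_le_orderBound hj hjK hδ0 hδ1 hR,
    ⟨hupper, fun b hb => hlower b (upperBounds_mono_set hsub hb)⟩,
    ⟨upperBounds_mono_set hsub hupper, hlower⟩,
    fun ε hε => ErasureBC.exists_multiphase 𝔽 hj hjK hδ0 hδ1 hε⟩
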